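/- **Setting.** Let $d\in\mathbb N_0$, let $\mathfrak L^-$ be a finite set, and let $0$ be an extra symbol. Fix a scaling $s\in[1,\infty)^d$ and write $|\mathbf n|=\sum_i s_i\mathbf n(i)$ for $\mathbf n\in\mathbb N_0^d$. Fix reals $\eta>0$, $\mathrm{regsol}$ and $\mathrm{reg}(\mathfrak l)$, $\mathfrak l\in\mathfrak L^-\cup\{0\}$, with $\mathrm{regsol}<\eta+\mathrm{reg}(\mathfrak l)$ for all $\mathfrak l$. $M(I)$ denotes the finitely supported maps $I\to\mathbb N_0$, with unit vectors $e_c$ and $\mathrm{length}(k)=\sum_c k(c)$. Consider the real formal power series in the variables $\mathsf z_{(\mathfrak l,k)}$, $\mathfrak l\in\mathfrak L^-\cup\{0\}$, $k\in M(\mathbb N_0^d)$, and $\mathsf z_{\mathbf n}$, $\mathbf n\in\mathbb N_0^d$, with monomials $\mathsf z^\beta$. For a set $V$ of multi-indices, $T^*_V$ is the space of power series supported on $V$. A pair $(\mathfrak l,k)$ is *subcritical* if $\mathrm{regsol}<\eta+\mathrm{reg}(\mathfrak l)$ and, for every $0\ne k'\le k$ and with $g(k')=\sum_{\mathbf n}(\mathrm{regsol}-|\mathbf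 n|)k'(\mathbf n)$, both $\mathrm{regsol}<\eta+g(k')$ and $\mathrm{regsol}<\eta+\mathrm{reg}(\mathfrak l)+g(k')$. Let $\mathcal N^-$ be the set of multi-indices $\beta$ such that $[\beta]:=\sum_{(\mathfrak l,k)}(1-\mathrm{length}(k))\beta(\mathfrak l,k)+\sum_{\mathbf n}\beta(\mathbf n)=1$, all $(\mathfrak l,k)$ with $\beta(\mathfrak l,k)\neq0$ are subcritical, and $\beta(\mathbf n)=0$ whenever $|\mathbf n|<\mathrm{regsol}$. Let $\mathcal N\subset\mathcal N^-$ consist of the $\beta\in\mathcal N^-$ with $\beta(\mathfrak l,k)>0$ for some $\mathfrak l\in\mathfrak L^-$ and some $k$. The *populated* multi-indices are $\{e_{\mathbf n}\}_{\mathbf n}\cup\mathcal N$. Let $\mathcal M=\mathcal N\times\mathbb N_0^d$ and $\mathcal M^-=\{(\gamma,\mathbf n)\in\mathcal M:|\mathbf n|<\eta\}$. Define the derivations $$D^{(\mathbf n)}=\sum_{(\mathfrak l,k):\ (\mathfrak l,k+e_{\mathbf n})\text{ subcritical}}(k(\mathbf n)+1)\,\mathsf z_{(\mathfrak l,k+e_{\mathbf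 n})}\partial_{\mathsf z_{(\mathfrak l,k)}}+\partial_{\mathsf z_{\mathbf n}},\qquad \boldsymbol\partial_i=\sum_{\mathbf n}(\mathbf n(i)+1)\,\mathsf z_{\mathbf n+e_i}D^{(\mathbf n)}.$$ Let $L$ be the Lie algebra of derivations generated by the $\boldsymbol\partial_i$ and by the $\mathsf z^\gamma D^{(\mathbf n)}$, where $\gamma$ satisfies the conditions defining $\mathcal N$, except possibly the vanishing of $\gamma(\mathbf m)$ for $|\mathbf m|<\mathrm{regsol}$. Let $\mathrm U(L)$ be its universal enveloping algebra and let $\rho$ be the action of $\mathrm U(L)$ on power series extending the natural action of $L$. On $\mathrm U(L)$ there are linear maps $U\mapsto\mathsf z^\gamma UD^{(\mathbf n)}$, determined by $1\mapsto\mathsf z^\gamma D^{(\mathbf n)}$ and, for $X\in L$, $\mathsf z^\gamma XUD^{(\mathbf n)}=X(\mathsf z^\gamma UD^{(\mathbf n)})-\sum_\beta X^\gamma_\beta\,\mathsf z^\beta UD^{(\mathbf n)}$, where $X\mathsf z^\gamma=\sum_\beta X_\beta^\gamma\mathsf z^\beta$. For $J\in M(\mathcal M)$ and $\mathbf m\in\mathbb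 N_0^d$ let $$\mathsf D_{(J,\mathbf m)}=\frac1{J!\,\mathbf m!}\prod_{(\gamma,\mathbf n)}(\mathsf z^\gamma)^{J(\gamma,\mathbf n)}\ \boldsymbol\partial^{\mathbf m}\prod_{(\gamma,\mathbf n)}(D^{(\mathbf n)})^{J(\gamma,\mathbf n)}\in\mathrm U(L),$$ obtained by applying these maps successively to $\boldsymbol\partial^{\mathbf m}=\prod_i\boldsymbol\partial_i^{\mathbf m(i)}$. Let $T^-=\mathbb R[\mathcal M^-\sqcup\{1,\dots,d\}]$, with generators $\mathsf Z_{(\gamma,\mathbf n)}$, $\mathsf Z_i$ and monomials $\mathsf Z^{(J,\mathbf m)}$. A character is an algebra morphism $\mathbf f:T^-\to\mathbb R$; write $\mathbf f^{(J,\mathbf m)}=\mathbf f(\mathsf Z^{(J,\mathbf m)})$ and $\mathbf f^{(\mathbf n)}_\gamma=\mathbf f(\mathsf Z_{(\gamma,\mathbf n)})$. Let $f^{(\mathbf n)}=\sum_\gamma f^{(\mathbf n)}_\gamma\mathsf z^\gamma$ be given by $$f^{(\mathbf n)}_\gamma=\begin{cases}\mathbf f^{(\mathbf n)}_\gamma&\text{if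 }(\gamma,\mathbf n)\in\mathcal M^-,\\ \binom{\mathbf m}{\mathbf n}\mathbf f^{(0,\mathbf m-\mathbf n)}&\text{if }\gamma=e_{\mathbf m},\ \mathbf n\le\mathbf m,\ \mathbf n\ne\mathbf m,\\0&\text{otherwise.}\end{cases}$$ **Part 1.** For every character $\mathbf f$, all $f^{(\mathbf n)}$ lie in $T^*_{\mathrm{populated}}$, and for all $\pi\in T^*_{\mathcal N^-}$ $$\Gamma_{\mathbf f}^{-*}\pi:=\sum_{(J,\mathbf m)\in M(\mathcal M^-)\times\mathbb N_0^d}\mathbf f^{(J,\mathbf m)}\rho(\mathsf D_{(J,\mathbf m)})\pi=\sum_{l\ge0}\frac1{l!}\sum_{\mathbf n_1,\dots,\mathbf n_l\in\mathbb N_0^d}f^{(\mathbf n_1)}\cdots f^{(\mathbf n_l)}D^{(\mathbf n_l)}\cdots D^{(\mathbf n_1)}\pi.$$ Both sums are effectively finite: for each $\beta$ only finitely many $(J,\mathbf m)$, respectively $(l;\mathbf n_1,\dots,\mathbf n_l)$, have a summand whose $\mathsf z^\beta$-coefficient is nonzero for some $\pi\in T^*_{\mathcal N^-}$. If moreover $\mathrm{regsol}\le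 s_i$ for all $i$, then $\Gamma^{-*}_{\mathbf f}$ maps $T^*_{\mathcal N^-}$ to itself. **Part 2.** Let $x\in\mathbb R^d$, let $\xi_{\mathfrak l}:\mathbb R^d\to\mathbb R$, $\mathfrak l\in\mathfrak L^-$, be functions, put $\xi_0=1$, and let $\Pi_x=\sum_\beta\Pi_{x\beta}\mathsf z^\beta$ have components $\Pi_{x\beta}:\mathbb R^d\to\mathbb R$ with $\Pi_{xe_{\mathbf n}}(y)=(y-x)^{\mathbf n}$, $\Pi_{x\beta}$ smooth for $\beta\in\mathcal N$, and $\Pi_{x\beta}=0$ if $\beta$ is not populated. For $y\in\mathbb R^d$ let $\mathbf\Pi_x(y)$ be the character with $\mathsf Z_{(\gamma,\mathbf n)}\mapsto\frac1{\mathbf n!}\partial^{\mathbf n}\Pi_{x\gamma}(y)$, $\mathsf Z_i\mapsto(y-x)_i$, and let $\Gamma^*_{\mathbf\Pi_x}$ be the associated map $\Gamma^{-*}_{\mathbf f}$, $\mathbf f=\mathbf\Pi_x(y)$. For a family $h=(h_{\mathbf n,\gamma})$ of functions set $$R_\beta[h]=\sum_{(\mathfrak l,k)}\ \sum_{e_{(\mathfrak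 l,k)}+\sum_{\mathbf n}\sum_{j=1}^{k(\mathbf n)}\beta_{\mathbf n}^j=\beta}\ \prod_{\mathbf n}\prod_{j=1}^{k(\mathbf n)}h_{\mathbf n,\beta^j_{\mathbf n}}\ \xi_{\mathfrak l}.$$ (a) For every $\beta\in\mathcal N$, pointwise on $\mathbb R^d$, $$R_\beta\big[\tfrac1{\mathbf n!}\partial^{\mathbf n}\Pi_{x\gamma}-\delta_\gamma^{e_{\mathbf n}}\big]=\Big(\Gamma^*_{\mathbf\Pi_x}\sum_{\mathfrak l\in\mathfrak L^-\cup\{0\}}\xi_{\mathfrak l}\mathsf z_{(\mathfrak l,0)}\Big)_\beta .$$ (b) If in addition $\beta(\mathbf n)=0$ for all $|\mathbf n|<\eta$, then also $R_\beta\big[\tfrac1{\mathbf n!}\partial^{\mathbf n}\Pi_{x\gamma}\big]=\big(\Gamma^*_{\mathbf\Pi_x}\sum_{\mathfrak l}\xi_{\mathfrak l}\mathsf z_{(\mathfrak l,0)}\big)_\beta$. (c) Consequently, for every operator $\mathcal L$ on functions $\mathbb R^d\to\mathbb R$, the hierarchy of model equations $\mathcal L\Pi_{x\beta}=R_\beta\big[\tfrac1{\mathbf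 n!}\partial^{\mathbf n}\Pi_{x\gamma}-\delta^{e_{\mathbf n}}_\gamma\big]$, $\beta\in\mathcal N$, is equivalent to $\mathcal L\Pi_{x\beta}=\big(\Gamma^*_{\mathbf\Pi_x}\sum_{\mathfrak l}\xi_{\mathfrak l}\mathsf z_{(\mathfrak l,0)}\big)_\beta$, $\beta\in\mathcal N$. -/

import Mathlib

open scoped Nat ContDiff

noncomputable section

namespace MultiIndex

/-- Multi-indices over `I`: finitely supported maps `I → ℕ`. -/
abbrev MI (I : Type*) := I →₀ ℕ

/-- `ℕ₀^d`. -/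
abbrev Idx (d : ℕ) := Fin d → ℕ

/-- The coordinates `(𝔩, k)`, with `𝔩 ∈ 𝔏⁻ ∪ {0}` (here `Option L`, with `none` for `0`) and
`k` a multi-index over `ℕ₀^d`, together with the coordinates `𝐧 ∈ ℕ₀^d`. -/
abbrev Coord (d : ℕ) (L : Type*) := (Option L × MI (Idx d)) ⊕ Idx d

/-- The power series algebra `ℝ[[coord]]`. -/
abbrev PS (d : ℕ) (L : Type*) := MvPowerSeries (Coord d L) ℝ

/-- The unit multi-index `e_c`. -/
abbrev e {I : Type*} (c : I) : MI I := Finsupp.single c 1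

/-- The monomial `𝗓^γ`. -/
abbrev zmon {d : ℕ} {L : Type*} (γ : MI (Coord d L)) : PS d L := MvPowerSeries.monomial γ 1

/-- The unit vector of `ℕ₀^d` in direction `i`. -/
abbrev unitIdx {d : ℕ} (i : Fin d) : Idx d := Pi.single i 1

/-- `𝐧! = ∏ 𝐧(i)!`. -/
def idxFactorial {d : ℕ} (n : Idx d) : ℕ := ∏ i, (n i)!

/-- `binom(𝐦, 𝐧) = ∏ binom(𝐦(i), 𝐧(i))`. -/
def idxChoose {d : ℕ} (m n : Idx d) : ℕ := ∏ i, (m i).choose (n i)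

/-- `J! = ∏ J(i)!`. -/
def miFactorial {I : Type*} (J : MI I) : ℕ := J.prod fun _ k => k !

/-- The length `∑ k(i)`. -/
def length {I : Type*} (k : MI I) : ℕ := k.sum fun _ a => a

/-! ### Locally finite sums of derivations -/

section SumDer

variable {σ ι : Type*}

/-- The derivation `∑ₜ T t` of `ℝ[[σ]]`, for a family in which every coefficient only sees
finitely many members. -/
def sumDer (T : ι → Derivation ℝ (MvPowerSeries σ ℝ) (MvPowerSeries σ ℝ))
    (hT : ∀ β, {t | ∃ a, MvPowerSeries.coeff β (T t a) ≠ 0}.Finite) :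
    Derivation ℝ (MvPowerSeries σ ℝ) (MvPowerSeries σ ℝ) := by
  classical
  have key : ∀ (β : σ →₀ ℕ) (a : MvPowerSeries σ ℝ) (s : Finset ι), (hT β).toFinset ⊆ s →
      ∑ᶠ t, MvPowerSeries.coeff β (T t a) = ∑ t ∈ s, MvPowerSeries.coeff β (T t a) := by
    intro β a s hs
    refine finsum_eq_sum_of_support_subset _ fun t ht => hs ?_
    simp only [Set.Finite.mem_toFinset, Set.mem_ofPred_eq]
    exact ⟨a, ht⟩
  refine Derivation.mk'
    { toFun := fun a => (fun β => ∑ᶠ t, MvPowerSeries.coeff β (T t a) : MvPowerSeries σ ℝ)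
      map_add' := ?_
      map_smul' := ?_ } ?_
  · intro a b
    ext β
    change ∑ᶠ t, MvPowerSeries.coeff β (T t (a + b)) =
      ∑ᶠ t, MvPowerSeries.coeff β (T t a) + ∑ᶠ t, MvPowerSeries.coeff β (T t b)
    rw [key β _ _ le_rfl, key β a _ le_rfl, key β b _ le_rfl]
    simp [Finset.sum_add_distrib]
  · intro r a
    ext β
    change ∑ᶠ t, MvPowerSeries.coeff β (T t (r • a)) = r • ∑ᶠ t, MvPowerSeries.coeff β (T t a)
    rw [key β _ _ le_rfl, key β a _ le_rfl]
    simp [Finset.mul_sum]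
  · intro a b
    ext β
    let s : Finset ι := (Finset.HasAntidiagonal.antidiagonal β).biUnion
      (fun p => (hT p.1).toFinset ∪ (hT p.2).toFinset)
    have h1 : ∀ p ∈ Finset.HasAntidiagonal.antidiagonal β, (hT p.1).toFinset ⊆ s := fun p hp t ht =>
      Finset.mem_biUnion.2 ⟨p, hp, Finset.mem_union_left _ ht⟩
    have h2 : ∀ p ∈ Finset.HasAntidiagonal.antidiagonal β, (hT p.2).toFinset ⊆ s := fun p hp t ht =>
      Finset.mem_biUnion.2 ⟨p, hp, Finset.mem_union_right _ ht⟩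
    have hβ : (hT β).toFinset ⊆ s := h1 (β, 0) (by simp)
    have hmul : ∀ (a b : MvPowerSeries σ ℝ),
        MvPowerSeries.coeff β
          (a * (show MvPowerSeries σ ℝ from fun β => ∑ᶠ t, MvPowerSeries.coeff β (T t b))) =
        ∑ t ∈ s, MvPowerSeries.coeff β (a * T t b) := by
      intro a b
      simp only [MvPowerSeries.coeff_mul]
      rw [Finset.sum_comm]
      refine Finset.sum_congr rfl fun p hp => ?_
      rw [← Finset.mul_sum]
      congr 1
      exact key p.2 b s (h2 p hp)
    change ∑ᶠ t, MvPowerSeries.coeff β (T t (a * b)) = MvPowerSeries.coeff β (a * _ + b * _)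
    rw [key β _ s hβ, map_add]
    erw [hmul a b, hmul b a]
    rw [← Finset.sum_add_distrib]
    refine Finset.sum_congr rfl fun t _ => ?_
    rw [Derivation.leibniz, map_add, smul_eq_mul, smul_eq_mul]

theorem coeff_sumDer (T : ι → Derivation ℝ (MvPowerSeries σ ℝ) (MvPowerSeries σ ℝ)) (hT)
    (a : MvPowerSeries σ ℝ) (β : σ →₀ ℕ) :
    MvPowerSeries.coeff β (sumDer T hT a) = ∑ᶠ t, MvPowerSeries.coeff β (T t a) := rfl

theorem sumDer_eq_sum (T : ι → Derivation ℝ (MvPowerSeries σ ℝ) (MvPowerSeries σ ℝ)) (hT)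
    (a : MvPowerSeries σ ℝ) (s : Finset ι) (hs : ∀ t, t ∉ s → T t a = 0) :
    sumDer T hT a = ∑ t ∈ s, T t a := by
  ext β
  rw [coeff_sumDer, map_sum]
  refine finsum_eq_sum_of_support_subset _ fun t ht => ?_
  by_contra hts
  exact ht (by simp [hs t hts])

theorem coeff_X_mul_eq_zero {c : σ} {β : σ →₀ ℕ} (h : β c = 0) (a : MvPowerSeries σ ℝ) :
    MvPowerSeries.coeff β (MvPowerSeries.X c * a) = 0 := by
  classical
  rw [MvPowerSeries.X_def, MvPowerSeries.coeff_monomial_mul, if_neg]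
  intro hle
  have := hle c
  simp [h] at this

/-- A derivation applied to a monomial. -/
theorem derivation_monomial (T : Derivation ℝ (MvPowerSeries σ ℝ) (MvPowerSeries σ ℝ))
    (γ : σ →₀ ℕ) :
    T (MvPowerSeries.monomial γ 1) =
      ∑ c ∈ γ.support,
        (γ c : ℝ) • (MvPowerSeries.monomial (γ - Finsupp.single c 1) 1 * T (MvPowerSeries.X c)) := by
  classical
  have hsupp : ∀ (γ : σ →₀ ℕ) (s : Finset σ), γ.support ⊆ s →
      ∑ c ∈ γ.support, (γ c : ℝ) •
        (MvPowerSeries.monomial (γ - Finsupp.single c 1) 1 * T (MvPowerSeries.X c)) =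
      ∑ c ∈ s, (γ c : ℝ) •
        (MvPowerSeries.monomial (γ - Finsupp.single c 1) 1 * T (MvPowerSeries.X c)) := by
    intro γ s hs
    refine Finset.sum_subset hs fun c _ hc => ?_
    rw [Finsupp.notMem_support_iff.1 hc]
    simp
  have mm : ∀ a b : σ →₀ ℕ, (MvPowerSeries.monomial (a + b) 1 : MvPowerSeries σ ℝ) =
      MvPowerSeries.monomial a 1 * MvPowerSeries.monomial b 1 := by
    intro a b
    rw [MvPowerSeries.monomial_mul_monomial, one_mul]
  induction γ using Finsupp.induction_linear with
  | zero =>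
    have : (MvPowerSeries.monomial (0 : σ →₀ ℕ) (1 : ℝ)) = 1 := rfl
    simp [this]
  | add f g hf hg =>
    have hs1 : (f + g).support ⊆ f.support ∪ g.support := Finsupp.support_add
    rw [mm, Derivation.leibniz, hf, hg, hsupp _ _ hs1,
      hsupp f _ Finset.subset_union_left, hsupp g _ Finset.subset_union_right, smul_eq_mul,
      smul_eq_mul, Finset.mul_sum, Finset.mul_sum, ← Finset.sum_add_distrib]
    refine Finset.sum_congr rfl fun c _ => ?_
    have hsub : ∀ a b : σ →₀ ℕ, a c ≠ 0 → a + b - Finsupp.single c 1 =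
        (a - Finsupp.single c 1) + b := by
      intro a b ha
      ext i
      by_cases hi : c = i
      · subst hi
        simp
        omega
      · simp [hi]
    by_cases h1 : f c = 0 <;> by_cases h2 : g c = 0
    · simp [h1, h2]
    · rw [add_comm f g, hsub g f h2, mm]
      simp [h1, Algebra.smul_def]
      ring
    · rw [hsub f g h1, mm]
      simp [h2, Algebra.smul_def]
      ring
    · have e1 := mm (f - Finsupp.single c 1) g
      have e2 := mm (g - Finsupp.single c 1) f
      rw [← hsub f g h1] at e1
      rw [← hsub g f h2, add_comm g f] at e2
      simp only [mul_smul_comm, ← mul_assoc]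
      rw [mul_comm (MvPowerSeries.monomial f 1), ← e2, mul_comm (MvPowerSeries.monomial g 1),
        ← e1, ← add_smul, Finsupp.add_apply, Nat.cast_add, add_comm]
  | single c n =>
    rcases Nat.eq_zero_or_pos n with rfl | hn
    · have : (MvPowerSeries.monomial (0 : σ →₀ ℕ) (1 : ℝ)) = 1 := rfl
      simp [this]
    · rw [Finsupp.support_single c hn.ne', Finset.sum_singleton, ← MvPowerSeries.X_pow_eq,
        Derivation.leibniz_pow, ← Finsupp.single_tsub, ← MvPowerSeries.X_pow_eq]
      simp [Algebra.smul_def]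

end SumDer

/-! ### The setting -/

/-- The data of a subcritical semilinear equation `ℒ u = ∑ a^𝔩(𝐮) ξ_𝔩`: a scaling `s`, the order
`η` of `ℒ`, the regularities `reg 𝔩` of the noises and the regularity `regsol` of the solution;
the additive noise terms are subcritical. -/
structure Setting (d : ℕ) (L : Type*) where
  s : Fin d → ℝ
  one_le_s : ∀ i, 1 ≤ s i
  η : ℝ
  η_pos : 0 < η
  reg : Option L → ℝ
  regsol : ℝ
  regsol_lt : ∀ l, regsol < η + reg l

namespace Setting

variable {d : ℕ} {L : Type*} (S : Setting d L)

/-- The scaled degree `|𝐧| = ∑ sᵢ 𝐧(i)`. -/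
def deg (n : Idx d) : ℝ := ∑ i, S.s i * n i

/-- `∑_𝐧 (regsol - |𝐧|) k(𝐧)`. -/
def gain (k : MI (Idx d)) : ℝ := k.sum fun n a => (S.regsol - S.deg n) * a

/-- Subcriticality of a pair `(𝔩, k)`:
`regsol < η + min {reg 𝔩, min_{0<k'≤k} gain k', reg 𝔩 + min_{0<k'≤k} gain k'}`,
where minima over the empty set are omitted. -/
def SubcritPair (p : Option L × MI (Idx d)) : Prop :=
  S.regsol < S.η + S.reg p.1 ∧
    ∀ k', 0 < k' → k' ≤ p.2 →
      S.regsol < S.η + S.gain k' ∧ S.regsol < S.η + (S.reg p.1 + S.gain k')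

/-- Subcriticality of a multi-index. -/
def Subcrit (β : MI (Coord d L)) : Prop := ∀ p, β (.inl p) ≠ 0 → S.SubcritPair p

end Setting

section Gradings

variable {d : ℕ} {L : Type*}

/-- `[β] = ∑ (1 - length k) β(𝔩,k) + ∑ β(𝐧)`. -/
def bracket (β : MI (Coord d L)) : ℤ :=
  β.sum fun c a => (a : ℤ) * Sum.elim (fun p => 1 - (length p.2 : ℤ)) (fun _ => 1) c

/-- The noise homogeneity: the sum of `β(𝔩,k)` over `𝔩 ∈ 𝔏⁻` and all `k`. -/
def noise (β : MI (Coord d L)) : ℕ :=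
  β.sum fun c a => a * Sum.elim (fun p => if p.1.isSome then 1 else 0) (fun _ => 0) c

theorem bracket_add (β γ : MI (Coord d L)) : bracket (β + γ) = bracket β + bracket γ :=
  Finsupp.sum_add_index' (by simp) (by intros; push_cast; ring)

theorem noise_add (β γ : MI (Coord d L)) : noise (β + γ) = noise β + noise γ :=
  Finsupp.sum_add_index' (by simp) (by intros; ring)

theorem bracket_e_inl (p : Option L × MI (Idx d)) :
    bracket (e (Sum.inl p : Coord d L)) = 1 - (length p.2 : ℤ) := by
  simp [bracket, Finsupp.sum_single_index]

theorem bracket_e_inr (n : Idx d) : bracket (e (Sum.inr n : Coord d L)) = 1 := by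
  simp [bracket, Finsupp.sum_single_index]

theorem noise_e_inl (p : Option L × MI (Idx d)) :
    noise (e (Sum.inl p : Coord d L)) = if p.1.isSome then 1 else 0 := by
  simp [noise, Finsupp.sum_single_index]

theorem noise_e_inr (n : Idx d) : noise (e (Sum.inr n : Coord d L)) = 0 := by
  simp [noise, Finsupp.sum_single_index]

theorem length_add_e (k : MI (Idx d)) (n : Idx d) : length (k + e n) = length k + 1 := by
  rw [length, Finsupp.sum_add_index' (by simp) (by simp)]
  simp [length, Finsupp.sum_single_index]

end Gradings

namespace Setting

variable {d : ℕ} {L : Type*} (S : Setting d L)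

/-! ### Index sets -/

/-- `𝒩⁻`: multi-indices with `[β] = 1`, subcritical, with `β(𝐧) = 0` for all `|𝐧| < regsol`. -/
def Nminus : Set (MI (Coord d L)) :=
  {β | bracket β = 1 ∧ S.Subcrit β ∧ ∀ n, S.deg n < S.regsol → β (.inr n) = 0}

/-- `𝒩`: the elements of `𝒩⁻` with positive noise homogeneity. -/
def N : Set (MI (Coord d L)) := {β | β ∈ S.Nminus ∧ 0 < noise β}

/-- The populated multi-indices `𝒫 ⊔ 𝒩`, with `𝒫 = {e_𝐧}`. -/
def populated : Set (MI (Coord d L)) := Set.range (fun n => e (Sum.inr n)) ∪ S.N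

/-- The same as `𝒩`, but without the requirement that `β(𝐧) = 0` for `|𝐧| < regsol`. This larger
index set is stable under all the derivations below whatever the scaling is, whereas `𝒩` is stable
under `𝛛ᵢ` only if `regsol ≤ sᵢ`. -/
def Nbar : Set (MI (Coord d L)) := {β | bracket β = 1 ∧ S.Subcrit β ∧ 0 < noise β}

theorem N_subset_Nbar : S.N ⊆ S.Nbar := fun _ h => ⟨h.1.1, h.1.2.1, h.2⟩

/-- The space `T*_V` of power series supported on `V`. -/
def T (V : Set (MI (Coord d L))) : Submodule ℝ (PS d L) where
  carrier := {π | ∀ β, β ∉ V → MvPowerSeries.coeff β π = 0}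
  add_mem' := fun ha hb β hβ => by simp [ha β hβ, hb β hβ]
  zero_mem' := by simp
  smul_mem' := fun r a ha β hβ => by simp [ha β hβ]

/-! ### The derivations -/

open scoped Classical in
/-- The term `(k(𝐧)+1) 𝗓_(𝔩,k+e_𝐧) ∂_{𝗓_(𝔩,k)}`, present if `(𝔩,k+e_𝐧)` is subcritical. -/
def DTerm (n : Idx d) (p : Option L × MI (Idx d)) : Derivation ℝ (PS d L) (PS d L) :=
  if S.SubcritPair (p.1, p.2 + e n) then
    ((p.2 n + 1 : ℝ) • (MvPowerSeries.X (.inl (p.1, p.2 + e n)) : PS d L)) •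
      MvPowerSeries.pderiv ℝ (.inl p)
  else 0

theorem DTerm_finite (n : Idx d) (β : MI (Coord d L)) :
    {p | ∃ a, MvPowerSeries.coeff β (S.DTerm n p a) ≠ 0}.Finite := by
  classical
  have hinj : Function.Injective
      (fun p : Option L × MI (Idx d) => (Sum.inl (p.1, p.2 + e n) : Coord d L)) := by
    rintro ⟨l, k⟩ ⟨l', k'⟩ h
    simpa using h
  refine (β.support.finite_toSet.preimage hinj.injOn).subset ?_
  rintro p ⟨a, ha⟩
  simp only [Set.mem_preimage, Finset.mem_coe, Finsupp.mem_support_iff]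
  intro h0
  apply ha
  unfold DTerm
  split_ifs
  · rw [Derivation.smul_apply, smul_eq_mul, smul_mul_assoc, map_smul,
      coeff_X_mul_eq_zero h0, smul_zero]
  · simp

/-- `D^(𝐧) = ∑_{(𝔩,k+e_𝐧) subcritical} (k(𝐧)+1) 𝗓_(𝔩,k+e_𝐧) ∂_{𝗓_(𝔩,k)} + ∂_{𝗓_𝐧}`. -/
def D (n : Idx d) : Derivation ℝ (PS d L) (PS d L) :=
  sumDer (S.DTerm n) (S.DTerm_finite n) + MvPowerSeries.pderiv ℝ (.inr n)

/-- The term `(𝐧(i)+1) 𝗓_{𝐧+eᵢ} D^(𝐧)`. -/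
def dTerm (i : Fin d) (n : Idx d) : Derivation ℝ (PS d L) (PS d L) :=
  ((n i + 1 : ℝ) • (MvPowerSeries.X (.inr (n + unitIdx i)) : PS d L)) • S.D n

theorem dTerm_finite (i : Fin d) (β : MI (Coord d L)) :
    {n | ∃ a, MvPowerSeries.coeff β (S.dTerm i n a) ≠ 0}.Finite := by
  classical
  have hinj : Function.Injective
      (fun n : Idx d => (Sum.inr (n + unitIdx i) : Coord d L)) := by
    intro n n' h
    simpa using h
  refine (β.support.finite_toSet.preimage hinj.injOn).subset ?_
  rintro n ⟨a, ha⟩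
  simp only [Set.mem_preimage, Finset.mem_coe, Finsupp.mem_support_iff]
  intro h0
  apply ha
  rw [dTerm, Derivation.smul_apply, smul_eq_mul, smul_mul_assoc, map_smul,
    coeff_X_mul_eq_zero h0, smul_zero]

/-- `𝛛ᵢ = ∑_𝐧 (𝐧(i)+1) 𝗓_{𝐧+eᵢ} D^(𝐧)`. -/
def del (i : Fin d) : Derivation ℝ (PS d L) (PS d L) := sumDer (S.dTerm i) (S.dTerm_finite i)

/-! ### The Lie algebra, its universal envelope, and the action -/

/-- The Lie algebra generated by the derivations `𝗓^γ D^(𝐧)` and `𝛛ᵢ`, with the commutator. -/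
def lie : LieSubalgebra ℝ (Derivation ℝ (PS d L) (PS d L)) :=
  LieSubalgebra.lieSpan ℝ _
    ({X | ∃ γ ∈ S.Nbar, ∃ n, X = zmon γ • S.D n} ∪ Set.range S.del)

/-- The universal enveloping algebra. -/
abbrev U := UniversalEnvelopingAlgebra ℝ S.lie

/-- The action `ρ` of the universal envelope on power series: the algebra morphism that extends
the inclusion of the Lie algebra. -/
def rho : S.U →ₐ[ℝ] Module.End ℝ (PS d L) :=
  UniversalEnvelopingAlgebra.lift ℝ (LieModule.toEnd ℝ S.lie (PS d L))

/-- `𝛛ᵢ` as an element of the Lie algebra. -/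
def lieDel (i : Fin d) : S.lie := ⟨S.del i, LieSubalgebra.subset_lieSpan (.inr ⟨i, rfl⟩)⟩

/-- The span of the monomials `𝗓^γ` with `γ` in the index set. -/
def W : Submodule ℝ (PS d L) := Submodule.span ℝ (zmon '' S.Nbar)

theorem smul_D_mem (n : Idx d) {w : PS d L} (hw : w ∈ S.W) : w • S.D n ∈ S.lie := by
  induction hw using Submodule.span_induction with
  | mem x hx =>
    obtain ⟨γ, hγ, rfl⟩ := hx
    exact LieSubalgebra.subset_lieSpan (.inl ⟨γ, hγ, n, rfl⟩)
  | zero => simp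
  | add x y _ _ hx hy => rw [add_smul]; exact add_mem hx hy
  | smul r x _ hx => rw [smul_assoc]; exact S.lie.smul_mem r hx

theorem D_X_inl (n : Idx d) (p : Option L × MI (Idx d)) :
    (S.SubcritPair (p.1, p.2 + e n) ∧ S.D n (MvPowerSeries.X (.inl p)) =
      (p.2 n + 1 : ℝ) • MvPowerSeries.X (.inl (p.1, p.2 + e n))) ∨
    S.D n (MvPowerSeries.X (.inl p)) = 0 := by
  classical
  have h : S.D n (MvPowerSeries.X (.inl p)) = S.DTerm n p (MvPowerSeries.X (.inl p)) := by
    rw [D, Derivation.add_apply, MvPowerSeries.pderiv_X_of_ne (by simp), add_zero,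
      sumDer_eq_sum _ _ _ {p}, Finset.sum_singleton]
    intro q hq
    unfold DTerm
    split_ifs
    · rw [Derivation.smul_apply, MvPowerSeries.pderiv_X_of_ne, smul_zero]
      simpa [eq_comm] using hq
    · simp
  rw [h]
  unfold DTerm
  split_ifs with hs
  · left
    exact ⟨hs, by simp⟩
  · right
    simp

theorem D_X_inr (n m : Idx d) :
    (m = n ∧ S.D n (MvPowerSeries.X (.inr m)) = 1) ∨
    (m ≠ n ∧ S.D n (MvPowerSeries.X (.inr m)) = 0) := by
  classical
  have h : S.D n (MvPowerSeries.X (.inr m)) =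
      MvPowerSeries.pderiv ℝ (.inr n) (MvPowerSeries.X (.inr m)) := by
    rw [D, Derivation.add_apply, sumDer_eq_sum _ _ _ ∅, Finset.sum_empty, zero_add]
    intro q _
    unfold DTerm
    split_ifs
    · rw [Derivation.smul_apply, MvPowerSeries.pderiv_X_of_ne (by simp), smul_zero]
    · simp
  rw [h]
  by_cases hm : m = n
  · left
    subst hm
    simp
  · right
    exact ⟨hm, MvPowerSeries.pderiv_X_of_ne (by simpa using hm)⟩

theorem deg_lt_of_subcrit {l : Option L} {k : MI (Idx d)} {n : Idx d}
    (h : S.SubcritPair (l, k + e n)) : S.deg n < S.η := by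
  have := (h.2 (e n) (by simp [pos_iff_ne_zero]) (by simp)).1
  simp only [gain, Finsupp.sum_single_index, Nat.cast_zero, Nat.cast_one, mul_zero, mul_one] at this
  linarith

theorem finite_deg_lt : {n : Idx d | S.deg n < S.η}.Finite := by
  obtain ⟨M, hM⟩ := exists_nat_gt S.η
  refine (Set.finite_Iic (fun _ : Fin d => M)).subset ?_
  intro n hn i
  have h1 : (n i : ℝ) ≤ S.s i * n i := le_mul_of_one_le_left (by positivity) (S.one_le_s i)
  have h2 : S.s i * n i ≤ S.deg n :=
    Finset.single_le_sum (f := fun i => S.s i * (n i : ℝ))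
      (fun j _ => mul_nonneg (zero_le_one.trans (S.one_le_s j)) (by positivity))
      (Finset.mem_univ i)
  have h3 : (n i : ℝ) < M := by
    have : S.deg n < S.η := hn
    linarith
  exact_mod_cast h3.le

theorem mul_D_mem {δ γ : MI (Coord d L)} (hδ : bracket δ = 1) (hδs : S.Subcrit δ)
    (hγ : γ ∈ S.Nbar) (n : Idx d) : zmon δ * S.D n (zmon γ) ∈ S.W := by
  classical
  obtain ⟨hb, hs, hn⟩ := hγ
  rw [derivation_monomial, Finset.mul_sum]
  refine Submodule.sum_mem _ fun c hc => ?_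
  rw [mul_smul_comm]
  refine Submodule.smul_mem _ _ ?_
  have hc' : γ c ≠ 0 := Finsupp.mem_support_iff.1 hc
  obtain ⟨γ', rfl⟩ : ∃ γ', γ = γ' + e c :=
    ⟨γ - e c, (tsub_add_cancel_of_le (by simpa [Nat.one_le_iff_ne_zero] using hc')).symm⟩
  rw [add_tsub_cancel_right]
  rw [bracket_add] at hb
  rw [noise_add] at hn
  have hs' : S.Subcrit γ' := fun p hp => hs p (by simp [hp])
  rcases c with p | m
  · rcases S.D_X_inl n p with ⟨hsub, h⟩ | h
    · rw [h, mul_smul_comm, mul_smul_comm]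
      refine Submodule.smul_mem _ _ (Submodule.subset_span
        ⟨δ + (γ' + e (.inl (p.1, p.2 + e n))), ⟨?_, ?_, ?_⟩, ?_⟩)
      · rw [bracket_add, bracket_add, bracket_e_inl, length_add_e]
        rw [bracket_e_inl] at hb
        push_cast
        linarith
      · intro q hq
        by_cases h1 : δ (.inl q) = 0
        · by_cases h2 : γ' (.inl q) = 0
          · have : q = (p.1, p.2 + e n) := by
              by_contra hne
              apply hq
              simp only [Finsupp.add_apply, h1, h2, Finsupp.single_apply, Sum.inl.injEq,
                if_neg (Ne.symm hne), add_zero]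
            rw [this]
            exact hsub
          · exact hs' q h2
        · exact hδs q h1
      · rw [noise_add, noise_add, noise_e_inl]
        rw [noise_e_inl] at hn
        dsimp only
        omega
      · simp [zmon, MvPowerSeries.X_def, MvPowerSeries.monomial_mul_monomial]
    · simp [h]
  · rcases S.D_X_inr n m with ⟨-, h⟩ | ⟨-, h⟩
    · rw [h, mul_one]
      refine Submodule.subset_span ⟨δ + γ', ⟨?_, ?_, ?_⟩, ?_⟩
      · rw [bracket_add]
        rw [bracket_e_inr] at hb
        linarith
      · intro q hq
        by_cases h1 : δ (.inl q) = 0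
        · exact hs' q (by simpa [h1] using hq)
        · exact hδs q h1
      · rw [noise_add]
        rw [noise_e_inr] at hn
        omega
      · simp [zmon, MvPowerSeries.monomial_mul_monomial]
    · simp [h]

theorem del_mem {γ : MI (Coord d L)} (hγ : γ ∈ S.Nbar) (i : Fin d) : S.del i (zmon γ) ∈ S.W := by
  classical
  let s : Finset (Idx d) := S.finite_deg_lt.toFinset ∪
    γ.support.biUnion (fun c => Sum.elim (fun _ => ∅) (fun m => {m}) c)
  rw [del, sumDer_eq_sum _ _ _ s]
  · refine Submodule.sum_mem _ fun n _ => ?_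
    rw [dTerm, Derivation.smul_apply, smul_eq_mul, smul_mul_assoc]
    refine Submodule.smul_mem _ _ (S.mul_D_mem (bracket_e_inr _) ?_ hγ n)
    intro q hq
    simp at hq
  · intro n hn
    simp only [s, Finset.mem_union, Set.Finite.mem_toFinset, Set.mem_ofPred_eq,
      Finset.mem_biUnion, not_or, not_exists, not_and] at hn
    rw [dTerm, Derivation.smul_apply, derivation_monomial, Finset.sum_eq_zero, smul_zero]
    intro c hc
    rcases c with p | m
    · rcases S.D_X_inl n p with ⟨hsub, _⟩ | h
      · exact absurd (S.deg_lt_of_subcrit hsub) hn.1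
      · simp [h]
    · rcases S.D_X_inr n m with ⟨h, _⟩ | ⟨_, h⟩
      · exact absurd (by simp [h]) (hn.2 _ hc)
      · simp [h]

theorem lie_stable (X : Derivation ℝ (PS d L) (PS d L)) (hX : X ∈ S.lie) :
    ∀ w ∈ S.W, X w ∈ S.W := by
  induction hX using LieSubalgebra.lieSpan_induction with
  | mem X hX =>
    intro w hw
    induction hw using Submodule.span_induction with
    | mem x hx =>
      obtain ⟨γ, hγ, rfl⟩ := hx
      rcases hX with ⟨δ, hδ, n, rfl⟩ | ⟨i, rfl⟩
      · exact S.mul_D_mem hδ.1 hδ.2.1 hγ n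
      · exact S.del_mem hγ i
    | zero => simp
    | add x y _ _ hx hy => rw [map_add]; exact add_mem hx hy
    | smul r x _ hx => rw [Derivation.map_smul]; exact S.W.smul_mem r hx
  | zero => simp
  | add X Y _ _ hX hY => exact fun w hw => add_mem (hX w hw) (hY w hw)
  | smul a X _ hX => exact fun w hw => S.W.smul_mem a (hX w hw)
  | lie X Y _ _ hX hY =>
    intro w hw
    rw [Derivation.commutator_apply]
    exact sub_mem (hX _ (hY w hw)) (hY _ (hX w hw))

/-- The Lie algebra acting on the span of the monomials. -/
def act (X : S.lie) : S.W →ₗ[ℝ] S.W :=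
  ((X : Derivation ℝ (PS d L) (PS d L)) : PS d L →ₗ[ℝ] PS d L).restrict (S.lie_stable X X.2)

/-- `w ↦ w D^(𝐧)`, with values in the universal envelope. -/
def seed (n : Idx d) : S.W →ₗ[ℝ] S.U where
  toFun w := UniversalEnvelopingAlgebra.ι ℝ (⟨(w : PS d L) • S.D n, S.smul_D_mem n w.2⟩ : S.lie)
  map_add' w v := by
    rw [← map_add]
    congr 1
    ext1
    exact add_smul _ _ _
  map_smul' r w := by
    rw [RingHom.id_apply, ← map_smul]
    congr 1
    ext1
    exact smul_assoc _ _ _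

attribute [local instance 100] LieRing.ofAssociativeRing

/-- The action of the Lie algebra on linear maps `g` from the span of the monomials to the
universal envelope: `(X·g)(w) = X g(w) - g(X w)`. -/
def twist : S.lie →ₗ⁅ℝ⁆ Module.End ℝ (S.W →ₗ[ℝ] S.U) where
  toFun X :=
    { toFun := fun g =>
        LinearMap.mulLeft ℝ (UniversalEnvelopingAlgebra.ι ℝ X) ∘ₗ g - g ∘ₗ S.act X
      map_add' := fun g h => by
        ext w
        simp [mul_add]
        abel
      map_smul' := fun r g => by
        ext w
        simp [smul_sub] }
  map_add' X Y := by
    ext g w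
    have : S.act (X + Y) w = S.act X w + S.act Y w := rfl
    simp [this, add_mul]
    abel
  map_smul' r X := by
    ext g w
    have : S.act (r • X) w = r • S.act X w := rfl
    simp [this, smul_sub]
  map_lie' {X Y} := by
    ext g w
    have : S.act ⁅X, Y⁆ w = S.act X (S.act Y w) - S.act Y (S.act X w) := rfl
    have h2 : UniversalEnvelopingAlgebra.ι ℝ ⁅X, Y⁆ =
        UniversalEnvelopingAlgebra.ι ℝ X * UniversalEnvelopingAlgebra.ι ℝ Y -
        UniversalEnvelopingAlgebra.ι ℝ Y * UniversalEnvelopingAlgebra.ι ℝ X := by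
      rw [LieHom.map_lie]
      rfl
    simp only [LinearMap.coe_mk, AddHom.coe_mk, LinearMap.sub_apply, LinearMap.comp_apply,
      LinearMap.mulLeft_apply, this, h2, LieRing.of_associative_ring_bracket,
      Module.End.mul_apply, map_sub, sub_mul, mul_assoc]
    abel

/-- The map `U ↦ 𝗓^γ U D^(𝐧)` of the universal envelope, extended linearly in `𝗓^γ`. -/
def graft (n : Idx d) (u : S.U) : S.W →ₗ[ℝ] S.U :=
  UniversalEnvelopingAlgebra.lift ℝ S.twist u (S.seed n)

theorem graft_one (n : Idx d) (w : S.W) : S.graft n 1 w =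
    UniversalEnvelopingAlgebra.ι ℝ
      (⟨(w : PS d L) • S.D n, S.smul_D_mem n w.2⟩ : S.lie) := by
  simp only [graft, map_one]
  rfl

/-- The recursion `𝗓^γ X U D^(𝐧) = X 𝗓^γ U D^(𝐧) - ∑_β X_β^γ 𝗓^β U D^(𝐧)`. -/
theorem graft_mul (n : Idx d) (X : S.lie) (u : S.U) (w : S.W) :
    S.graft n (UniversalEnvelopingAlgebra.ι ℝ X * u) w =
      UniversalEnvelopingAlgebra.ι ℝ X * S.graft n u w - S.graft n u (S.act X w) := by
  simp only [graft, map_mul, UniversalEnvelopingAlgebra.lift_ι_apply, Module.End.mul_apply]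
  rfl

/-- `ℳ = 𝒩 × ℕ₀^d`. -/
abbrev M := S.N × Idx d

/-- The monomial `𝗓^γ`, `γ ∈ 𝒩`, as an element of the span. -/
def zN (γ : S.N) : S.W := ⟨zmon γ.1, Submodule.subset_span ⟨γ.1, S.N_subset_Nbar γ.2, rfl⟩⟩

/-- The basis element
`𝖣_(J,𝐦) = (1/(J! 𝐦!)) ∏ (𝗓^γ)^{J(γ,𝐧)} 𝛛^𝐦 ∏ (D^(𝐧))^{J(γ,𝐧)}` of the universal envelope:
the maps `U ↦ 𝗓^γ U D^(𝐧)` are applied successively, `J(γ,𝐧)` times each and in any order,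
to `𝛛^𝐦`. -/
def Dbasis (J : MI S.M) (m : Idx d) : S.U :=
  ((miFactorial J * idxFactorial m : ℕ) : ℝ)⁻¹ •
    (Finsupp.toMultiset J).toList.foldr (fun p u => S.graft p.2 u (S.zN p.1))
      (List.ofFn fun i => UniversalEnvelopingAlgebra.ι ℝ (S.lieDel i) ^ m i).prod

/-! ### Characters and the associated maps -/

/-- `ℳ⁻`: the pairs `(γ,𝐧) ∈ ℳ` with `|𝐧| < η`. -/
abbrev Mminus := {p : S.M // S.deg p.2 < S.η}

/-- The free commutative algebra `T⁻ = ℝ[ℳ⁻ ⊔ {1,…,d}]`. -/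
abbrev Tminus := MvPolynomial (S.Mminus ⊕ Fin d) ℝ

/-- The characters of `T⁻`. -/
abbrev Char := S.Tminus →ₐ[ℝ] ℝ

variable {S} in
/-- `𝐟^(J,𝐦)`, the value of the character on the monomial `𝖹^(J,𝐦)`. -/
def Char.val (f : S.Char) (J : MI S.Mminus) (m : Idx d) : ℝ :=
  f ((J.prod fun p k => MvPolynomial.X (.inl p) ^ k) * ∏ i, MvPolynomial.X (.inr i) ^ m i)

variable {S} in
/-- The summand `𝐟^(J,𝐦) ρ(𝖣_(J,𝐦))`. -/
def Char.gammaTerm (f : S.Char) (q : MI S.Mminus × Idx d) : PS d L →ₗ[ℝ] PS d L :=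
  f.val q.1 q.2 • S.rho (S.Dbasis (q.1.mapDomain Subtype.val) q.2)

variable {S} in
/-- `Γ_𝐟^{-*} π = ∑_(J,𝐦) 𝐟^(J,𝐦) ρ(𝖣_(J,𝐦)) π`, coefficient by coefficient. -/
def Char.gamma (f : S.Char) (π : PS d L) : PS d L :=
  fun β => ∑ᶠ q, MvPowerSeries.coeff β (f.gammaTerm q π)

variable {S} in
open scoped Classical in
/-- The power series `f^(𝐧)`, with coefficients `𝐟_γ^(𝐧)` for `(γ,𝐧) ∈ ℳ⁻`,
`binom(𝐦,𝐧) 𝐟^(0,𝐦-𝐧)` for the multi-indices `e_𝐦` with `𝐧 < 𝐦` (that is, `𝐧 ≤ 𝐦` and `𝐧 ≠ 𝐦`),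
and zero for all other multi-indices. -/
def Char.series (f : S.Char) (n : Idx d) : PS d L := fun γ =>
  if h : ∃ _ : γ ∈ S.N, S.deg n < S.η then
    f (MvPolynomial.X (.inl ⟨(⟨γ, h.1⟩, n), h.2⟩))
  else if h : ∃ m, γ = e (.inr m) ∧ n < m then
    idxChoose h.choose n * f.val 0 (h.choose - n)
  else 0

variable {S} in
/-- `f^(𝐧₁) ⋯ f^(𝐧_l) D^(𝐧_l) ⋯ D^(𝐧₁) π`. -/
def Char.expTerm (f : S.Char) {l : ℕ} (ν : Fin l → Idx d) (π : PS d L) : PS d L :=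
  (∏ j, f.series (ν j)) *
    ((List.ofFn fun j => ((S.D (ν j) : PS d L →ₗ[ℝ] PS d L) : Module.End ℝ (PS d L))).reverse.prod
      π)

variable {S} in
/-- `∑_l (1/l!) ∑_{𝐧₁,…,𝐧_l} f^(𝐧₁) ⋯ f^(𝐧_l) D^(𝐧_l) ⋯ D^(𝐧₁) π`, coefficient by coefficient. -/
def Char.exponential (f : S.Char) (π : PS d L) : PS d L :=
  fun β => ∑ᶠ l : ℕ, (l ! : ℝ)⁻¹ *
    ∑ᶠ ν : Fin l → Idx d, MvPowerSeries.coeff β (f.expTerm ν π)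

end Setting

/-! ### The model equations -/

/-- The `i`-th partial derivative. -/
def partialD {d : ℕ} (i : Fin d) (g : (Fin d → ℝ) → ℝ) : (Fin d → ℝ) → ℝ :=
  fun y => fderiv ℝ g y (Pi.single i 1)

/-- `(1/𝐧!) ∂^𝐧 g`. -/
def taylorCoeff {d : ℕ} (n : Idx d) (g : (Fin d → ℝ) → ℝ) (y : Fin d → ℝ) : ℝ :=
  (idxFactorial n : ℝ)⁻¹ *
    (List.finRange d).foldr (fun i h => (partialD i)^[n i] h) g y

/-- The noises, with `ξ₀ = 1`. -/
def noiseVal {d : ℕ} {L : Type*} (ξ : L → (Fin d → ℝ) → ℝ) (y : Fin d → ℝ) : Option L → ℝ :=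
  fun l => l.elim 1 fun l => ξ l y

/-- `∑_(𝔩,k) ∑ ∏_𝐧 ∏_{j=1}^{k(𝐧)} h(𝐧, β_𝐧^j) ξ_𝔩`, where the inner sum runs over all families
`(β_𝐧^j)` of multi-indices with `e_(𝔩,k) + ∑_𝐧 ∑_j β_𝐧^j = β`. -/
def hierarchyRHS {d : ℕ} {L : Type*} (h : Idx d → MI (Coord d L) → ℝ) (ξ : Option L → ℝ)
    (β : MI (Coord d L)) : ℝ :=
  ∑ᶠ p : Option L × MI (Idx d),
    ∑ᶠ (b : ((n : p.2.support) × Fin (p.2 n)) → MI (Coord d L))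
      (_ : e (.inl p) + ∑ t, b t = β), (∏ t, h t.1 (b t)) * ξ p.1

namespace Setting

variable {d : ℕ} {L : Type*} (S : Setting d L)

/-- A smooth `Π_x : ℝ^d → T*_populated` with `Π_{x e_𝐧} = (· - x)^𝐧`, as a family of components. -/
structure IsExpansion (x : Fin d → ℝ) (P : MI (Coord d L) → (Fin d → ℝ) → ℝ) : Prop where
  polynomial : ∀ n y, P (e (.inr n)) y = ∏ i, (y i - x i) ^ n i
  smooth : ∀ β ∈ S.N, ContDiff ℝ ∞ (P β)
  populated : ∀ β, β ∉ S.populated → P β = 0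

/-- The character `𝚷_x` at the point `y`:
`𝖹_(γ,𝐧) ↦ (1/𝐧!) ∂^𝐧 Π_{xγ}(y)` and `𝖹_i ↦ (y - x)_i`. -/
def modelChar (x : Fin d → ℝ) (P : MI (Coord d L) → (Fin d → ℝ) → ℝ) (y : Fin d → ℝ) : S.Char :=
  MvPolynomial.aeval
    (Sum.elim (fun p => taylorCoeff p.1.2 (P p.1.1) y) (fun i => y i - x i))

/-- The component `(Γ*_{𝚷_x} ∑_𝔩 𝗓_(𝔩,0) ξ_𝔩)_β` at the point `y`. -/
def gammaRHS [Fintype L] (x : Fin d → ℝ) (P : MI (Coord d L) → (Fin d → ℝ) → ℝ)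
    (ξ : L → (Fin d → ℝ) → ℝ) (β : MI (Coord d L)) (y : Fin d → ℝ) : ℝ :=
  MvPowerSeries.coeff β
    ((S.modelChar x P y).gamma (∑ l, noiseVal ξ y l • MvPowerSeries.X (.inl (l, 0))))

end Setting

/-- The right-hand side of the model equation, at the point `y`, with the products of the
`(1/𝐧!) ∂^𝐧 Π_{xβ_𝐧^j}`. -/
def plainRHS {d : ℕ} {L : Type*} (P : MI (Coord d L) → (Fin d → ℝ) → ℝ)
    (ξ : L → (Fin d → ℝ) → ℝ) (β : MI (Coord d L)) (y : Fin d → ℝ) : ℝ :=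
  hierarchyRHS (fun n γ => taylorCoeff n (P γ) y) (noiseVal ξ y) β

open scoped Classical in
/-- The right-hand side of the model equation, at the point `y`, when the nonlinearity is expanded
around the jet `(𝗓_𝐧)`: the products are those of the coefficients
`(1/𝐧!) ∂^𝐧 Π_{xβ_𝐧^j} - δ(β_𝐧^j, e_𝐧)` of the increments `(1/𝐧!) ∂^𝐧 Π_x - 𝗓_𝐧`. -/
def incrementRHS {d : ℕ} {L : Type*} (P : MI (Coord d L) → (Fin d → ℝ) → ℝ)
    (ξ : L → (Fin d → ℝ) → ℝ) (β : MI (Coord d L)) (y : Fin d → ℝ) : ℝ :=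
  hierarchyRHS (fun n γ => taylorCoeff n (P γ) y - if γ = e (.inr n) then 1 else 0)
    (noiseVal ξ y) β

end MultiIndex

end

open scoped Nat ContDiff

noncomputable section

/-! Since the derivations `D^(𝐧)` commute, an operator `∑ c_k D^k` with all multiplications on the
left is encoded by its symbol, the polynomial `∑ c_k 𝖷^k` over the power series ring
(`normalOrder`). The right-hand side of Part 1 is the operator with symbol `exp(∑_𝐧 f^(𝐧) 𝖷_𝐧)`; the
point is that `Γ` has the same symbol.

The recursion that defines `U ↦ 𝗓^γ U D^(𝐧)` is the Leibniz rule in disguise (`rho_graft`), so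
`𝖣_(J,𝐦)` acts as `𝗓^J 𝛛^𝐦 D^J / (J! 𝐦!)`, and only `𝛛^𝐦` has to be normal-ordered. Let `H(𝗍) = ∑_𝐧
∑_{𝐮≠0} binom(𝐧+𝐮,𝐧) 𝗍^𝐮 𝗓_{𝐧+𝐮} 𝖷_𝐧`. With `σᵢ` the symbol of `𝛛ᵢ`, and `𝛛ᵢ` acting on
coefficients, an identity between binomials gives `∂_{𝗍ᵢ} H = 𝛛ᵢ H + σᵢ` (`pderiv_shiftSymbol`).
Hence `E = exp H` solves `∂_{𝗍ᵢ} E = 𝛛ᵢ E + σᵢ E`, which is the recursion for the symbols of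
`𝛛^𝐦/𝐦!`; these are therefore the coefficients `[𝗍^𝐦] exp H`. A character is multiplicative, so the
sum over `(J,𝐦)` factorises into `exp(∑ 𝐟_γ^(𝐧) 𝗓^γ 𝖷_𝐧)` times `exp H` evaluated at the values of
the `𝖹ᵢ`. The two exponents add up to `∑_𝐧 f^(𝐧) 𝖷_𝐧` (`symbol_sub_mem`).

To avoid infinite sums, one coefficient `β` is treated at a time. A bound `B` leaves finitely many
`𝐧`, and power series without constant term have their `(|β|+1)`-st power in the ideal `belowIdeal
β`, modulo which truncated exponentials obey the exponential law. The derivations do not preserve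
this ideal, so the differential equation is solved exactly, degree by degree in `𝗍`, with the
variables `𝗓_𝐧`, `𝐧 ≰ B`, set to zero; only afterwards are symbols reduced modulo the ideal.

The space over `𝒩⁻` is preserved because each `D^(𝐧)` lowers the bracket by one and each `f^(𝐧)`
restores it. For Part 2, `D^k 𝗓_(𝔩,0)` is `k! 𝗓_(𝔩,k)` for subcritical `(𝔩,k)` and zero otherwise,
so the exponential formula reads `∑ ξ_𝔩 𝗓_(𝔩,k) ∏ (f^(𝐧))^{k(𝐧)}`. This is the hierarchy with `h =
f^(𝐧)`, and `f^(𝐧)` is the increment of the jet when `|𝐧| < η`. -/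

namespace MultiIndex

/-! ### Truncated exponentials and the exponential law modulo an ideal -/

section TruncatedExponential

variable {A B : Type*} [CommRing A] [Algebra ℝ A] [CommRing B] [Algebra ℝ B]

/-- The truncated exponential `∑_{l < L} x^l / l!`. -/
def truncExp (L : ℕ) (x : A) : A := ∑ l ∈ Finset.range L, (l ! : ℝ)⁻¹ • x ^ l

/-- An exact identity, at the price of one order of truncation. Exactness matters because it is
applied to derivations that do not preserve the ideals used elsewhere. -/
theorem derivation_truncExp_succ (δ : Derivation ℝ A A) (L : ℕ) (x : A) :
    δ (truncExp (L + 1) x) = truncExp L x * δ x := by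
  rw [truncExp, Finset.sum_range_succ', map_add, map_sum, truncExp, Finset.sum_mul]
  simp only [pow_zero, Derivation.map_smul, Derivation.map_one_eq_zero, smul_zero, add_zero]
  refine Finset.sum_congr rfl fun l _ => ?_
  rw [Derivation.leibniz_pow, Nat.add_sub_cancel, smul_eq_mul, ← Nat.cast_smul_eq_nsmul ℝ, smul_smul,
    smul_mul_assoc]
  congr 1
  have : (l ! : ℝ) ≠ 0 := by positivity
  rw [Nat.factorial_succ]
  push_cast
  field_simp

theorem truncExp_sub_mem {I : Ideal A} {x y : A} (h : x - y ∈ I) (L : ℕ) :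
    truncExp L x - truncExp L y ∈ I := by
  rw [truncExp, truncExp, ← Finset.sum_sub_distrib]
  refine Submodule.sum_mem _ fun l _ => ?_
  rw [← smul_sub]
  exact Submodule.smul_of_tower_mem I _ (I.mem_of_dvd (sub_dvd_pow_sub_pow x y l) h)

theorem truncExp_sub_truncExp_mem {M I : Ideal A} {L L' : ℕ} (hM : M ^ L ≤ I) {x : A}
    (hx : x ∈ M) (hL : L ≤ L') : truncExp L' x - truncExp L x ∈ I := by
  rw [truncExp, truncExp, ← Finset.sum_sdiff (Finset.range_subset_range.2 hL), add_sub_cancel_right]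
  refine Submodule.sum_mem _ fun l hl => Submodule.smul_of_tower_mem I _ (hM ?_)
  simp only [Finset.mem_sdiff, Finset.mem_range, not_lt] at hl
  exact Ideal.pow_le_pow_right hl.2 (Ideal.pow_mem_pow hx l)

/-- The product runs over the square of exponents `i, j < L`, the exponential of the sum over the
triangle `i + j < L` by the binomial theorem; what lies between has total order at least `L`. -/
theorem truncExp_mul_sub_truncExp_add_mem {M I : Ideal A} {L : ℕ} (hM : M ^ L ≤ I) {x y : A}
    (hx : x ∈ M) (hy : y ∈ M) : truncExp L x * truncExp L y - truncExp L (x + y) ∈ I := by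
  have h1 : truncExp L (x + y) = ∑ i ∈ Finset.range L, ∑ j ∈ Finset.range (L - i),
      ((i ! : ℝ)⁻¹ * (j ! : ℝ)⁻¹) • (x ^ i * y ^ j) := by
    rw [← Finset.sum_range_diag_flip L
      (fun i j => ((i ! : ℝ)⁻¹ * (j ! : ℝ)⁻¹) • (x ^ i * y ^ j)), truncExp]
    refine Finset.sum_congr rfl fun l _ => ?_
    rw [add_pow, Finset.smul_sum]
    refine Finset.sum_congr rfl fun k hk => ?_
    have hk' : k ≤ l := Nat.lt_succ_iff.1 (Finset.mem_range.1 hk)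
    rw [← nsmul_eq_mul', ← Nat.cast_smul_eq_nsmul ℝ, smul_smul, Nat.cast_choose ℝ hk']
    congr 1
    have := Nat.factorial_ne_zero l
    field_simp
  have h2 : truncExp L x * truncExp L y = ∑ i ∈ Finset.range L, ∑ j ∈ Finset.range L,
      ((i ! : ℝ)⁻¹ * (j ! : ℝ)⁻¹) • (x ^ i * y ^ j) := by
    simp only [truncExp, Finset.sum_mul_sum, smul_mul_smul_comm]
  rw [h1, h2, ← Finset.sum_sub_distrib]
  refine Submodule.sum_mem _ fun i _ => ?_
  rw [← Finset.sum_sdiff (Finset.range_subset_range.2 (Nat.sub_le L i)), add_sub_cancel_right]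
  refine Submodule.sum_mem _ fun j hj => Submodule.smul_of_tower_mem I _ (hM ?_)
  simp only [Finset.mem_sdiff, Finset.mem_range, not_lt] at hj
  have : x ^ i * y ^ j ∈ M ^ (i + j) := by
    rw [pow_add]
    exact Ideal.mul_mem_mul (Ideal.pow_mem_pow hx i) (Ideal.pow_mem_pow hy j)
  exact Ideal.pow_le_pow_right (by omega) this

open scoped Classical in
/-- The multi-indices of length less than `L` that are supported in `s`. -/
def multiIndices {ι : Type*} (s : Finset ι) (L : ℕ) : Finset (MI ι) :=
  (Finset.range L).biUnion fun l => s.finsuppAntidiag l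

theorem mem_multiIndices {ι : Type*} {s : Finset ι} {L : ℕ} {k : MI ι} :
    k ∈ multiIndices s L ↔ k.support ⊆ s ∧ length k < L := by
  classical
  simp only [multiIndices, Finset.mem_biUnion, Finset.mem_range, Finset.mem_finsuppAntidiag']
  constructor
  · rintro ⟨l, hl, h1, h2⟩
    exact ⟨h2, by rw [length, h1]; exact hl⟩
  · rintro ⟨h1, h2⟩
    exact ⟨_, h2, rfl, h1⟩

/-- The multinomial theorem, organised so that the weights are `1/k!`; this is what produces the
factors `1/J!` in `𝖣_(J,𝐦)`. -/
theorem truncExp_sum {ι : Type*} (s : Finset ι) (L : ℕ) (c : ι → A) :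
    truncExp L (∑ i ∈ s, c i) =
      ∑ k ∈ multiIndices s L, (miFactorial k : ℝ)⁻¹ • k.prod fun i a => c i ^ a := by
  classical
  rw [multiIndices, Finset.sum_biUnion]
  · refine Finset.sum_congr rfl fun l _ => ?_
    rw [Finset.sum_pow_eq_sum_piAntidiag, Finset.smul_sum]
    symm
    refine Finset.sum_bij' (fun k _ => (k : ι → ℕ))
      (fun k hk => Finsupp.onFinset s k (Finset.mem_piAntidiag.1 hk).2) ?_ ?_ ?_ ?_ ?_
    · intro k hk
      rw [Finset.mem_finsuppAntidiag] at hk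
      exact Finset.mem_piAntidiag.2 ⟨hk.1, fun i hi => hk.2 (Finsupp.mem_support_iff.2 hi)⟩
    · intro k hk
      have := Finset.mem_piAntidiag.1 hk
      rw [Finset.mem_finsuppAntidiag]
      refine ⟨this.1, Finsupp.support_onFinset_subset⟩
    · intro k hk
      ext
      rfl
    · intro k hk
      rfl
    · intro k hk
      rw [Finset.mem_finsuppAntidiag] at hk
      have e1 : (k.prod fun i a => c i ^ a) = ∏ i ∈ s, c i ^ k i :=
        Finsupp.prod_of_support_subset _ hk.2 _ (by simp)
      have e2 : miFactorial k = ∏ i ∈ s, (k i)! :=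
        Finsupp.prod_of_support_subset _ hk.2 _ (by simp)
      rw [e1, ← nsmul_eq_mul, ← Nat.cast_smul_eq_nsmul ℝ, smul_smul]
      congr 1
      have h3 := Nat.multinomial_spec s (k : ι → ℕ)
      rw [hk.1, ← e2] at h3
      rw [← h3]
      have h4 : (miFactorial k : ℝ) ≠ 0 := by
        rw [e2]
        exact_mod_cast Finset.prod_ne_zero_iff.2 fun i _ => Nat.factorial_ne_zero _
      have h5 : (Nat.multinomial s (k : ι → ℕ) : ℝ) ≠ 0 := by
        intro h
        rw [Nat.cast_eq_zero] at h
        rw [h, mul_zero] at h3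
        exact Nat.factorial_ne_zero _ h3.symm
      push_cast
      field_simp
  · intro l _ l' _ hne
    refine Finset.disjoint_left.2 fun k hk hk' => hne ?_
    rw [Finset.mem_finsuppAntidiag] at hk hk'
    rw [← hk.1, ← hk'.1]

end TruncatedExponential

section CoefficientwiseDerivation

variable {σ A : Type*} [CommRing A] [Algebra ℝ A]

/-- The derivation of a polynomial ring that applies a derivation to the coefficients. -/
def coeffDer (δ : Derivation ℝ A A) : Derivation ℝ (MvPolynomial σ A) (MvPolynomial σ A) :=
  Derivation.mk'
    { toFun := fun p => ⟨Finsupp.mapRange δ (map_zero δ) (AddMonoidAlgebra.coeff p)⟩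
      map_add' := fun p q => by
        ext m
        exact map_add δ (MvPolynomial.coeff m p) (MvPolynomial.coeff m q)
      map_smul' := fun r p => by
        ext m
        exact δ.map_smul r (MvPolynomial.coeff m p) } <| by
    classical
    intro p q
    ext m
    change δ (MvPolynomial.coeff m (p * q)) = _
    rw [smul_eq_mul, smul_eq_mul, mul_comm q, MvPolynomial.coeff_add, MvPolynomial.coeff_mul,
      MvPolynomial.coeff_mul, MvPolynomial.coeff_mul, map_sum, ← Finset.sum_add_distrib]
    refine Finset.sum_congr rfl fun x _ => ?_
    rw [Derivation.leibniz, smul_eq_mul, smul_eq_mul, mul_comm (MvPolynomial.coeff x.2 q)]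
    rfl

theorem coeff_coeffDer (δ : Derivation ℝ A A) (p : MvPolynomial σ A) (m : σ →₀ ℕ) :
    (coeffDer δ p).coeff m = δ (p.coeff m) := rfl

theorem coeffDer_monomial (δ : Derivation ℝ A A) (m : σ →₀ ℕ) (a : A) :
    coeffDer δ (MvPolynomial.monomial m a) = MvPolynomial.monomial m (δ a) := by
  classical
  ext m'
  rw [coeff_coeffDer]
  simp only [MvPolynomial.coeff_monomial]
  split_ifs <;> simp

end CoefficientwiseDerivation

/-! ### Ideals that control one coefficient, and locality of operators -/

section CoefficientIdeals

variable {σ : Type*}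

/-- The ideal of the power series without coefficients at or below `β`. -/
def belowIdeal (β : σ →₀ ℕ) : Ideal (MvPowerSeries σ ℝ) where
  carrier := {a | ∀ γ ≤ β, MvPowerSeries.coeff γ a = 0}
  add_mem' ha hb γ hγ := by rw [map_add, ha γ hγ, hb γ hγ, add_zero]
  zero_mem' := by simp
  smul_mem' c a ha γ hγ := by
    classical
    rw [smul_eq_mul, MvPowerSeries.coeff_mul]
    refine Finset.sum_eq_zero fun x hx => ?_
    rw [ha x.2 ((Finset.HasAntidiagonal.antidiagonal.snd_le hx).trans hγ), mul_zero]

/-- Each factor without constant term raises the degree by at least one, so a product of more than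
`|β|` of them has nothing at or below `β`. -/
theorem ker_constantCoeff_pow_le (β : σ →₀ ℕ) {L : ℕ} (hL : β.degree < L) :
    RingHom.ker (MvPowerSeries.constantCoeff (σ := σ) (R := ℝ)) ^ L ≤ belowIdeal β := by
  classical
  suffices h : ∀ L : ℕ, ∀ a ∈ RingHom.ker (MvPowerSeries.constantCoeff (σ := σ) (R := ℝ)) ^ L,
      ∀ γ : σ →₀ ℕ, γ.degree < L → MvPowerSeries.coeff γ a = 0 from
    fun a ha γ hγ => h L a ha γ ((Finsupp.degree_mono hγ).trans_lt hL)
  intro L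
  induction L with
  | zero => intro a _ γ hγ; exact absurd hγ (Nat.not_lt_zero _)
  | succ L ih =>
    intro a ha
    rw [pow_succ] at ha
    induction ha using Submodule.mul_induction_on' with
    | mem_mul_mem x hx y hy =>
      intro γ hγ
      rw [MvPowerSeries.coeff_mul]
      refine Finset.sum_eq_zero fun p hp => ?_
      by_cases h0 : p.2 = 0
      · rw [h0, MvPowerSeries.coeff_zero_eq_constantCoeff, RingHom.mem_ker.1 hy, mul_zero]
      · rw [ih x hx p.1, zero_mul]
        have h1 := Finset.HasAntidiagonal.mem_antidiagonal.1 hp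
        rw [← h1, map_add] at hγ
        have : p.2.degree ≠ 0 := fun h => h0 ((Finsupp.degree_eq_zero_iff _).1 h)
        omega
    | add x _ y _ hx hy =>
      intro γ hγ
      rw [map_add, hx γ hγ, hy γ hγ, add_zero]

end CoefficientIdeals

section Locality

variable {σ : Type*}

/-- Every coefficient of the image depends only on finitely many coefficients. -/
def CoeffLocal (T : MvPowerSeries σ ℝ →ₗ[ℝ] MvPowerSeries σ ℝ) : Prop :=
  ∀ β, ∃ F : Finset (σ →₀ ℕ), ∀ a, (∀ γ ∈ F, MvPowerSeries.coeff γ a = 0) →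
    MvPowerSeries.coeff β (T a) = 0

theorem CoeffLocal.comp {T T' : MvPowerSeries σ ℝ →ₗ[ℝ] MvPowerSeries σ ℝ} (hT : CoeffLocal T)
    (hT' : CoeffLocal T') : CoeffLocal (T ∘ₗ T') := by
  classical
  intro β
  obtain ⟨F, hF⟩ := hT β
  choose G hG using hT'
  exact ⟨F.biUnion G, fun a ha => hF _ fun γ hγ => hG γ a fun δ hδ =>
    ha δ (Finset.mem_biUnion.2 ⟨γ, hγ, hδ⟩)⟩

theorem CoeffLocal.sub {T T' : MvPowerSeries σ ℝ →ₗ[ℝ] MvPowerSeries σ ℝ} (hT : CoeffLocal T)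
    (hT' : CoeffLocal T') : CoeffLocal (T - T') := by
  classical
  intro β
  obtain ⟨F, hF⟩ := hT β
  obtain ⟨G, hG⟩ := hT' β
  refine ⟨F ∪ G, fun a ha => ?_⟩
  rw [LinearMap.sub_apply, map_sub, hF a fun γ hγ => ha γ (Finset.mem_union_left _ hγ),
    hG a fun γ hγ => ha γ (Finset.mem_union_right _ hγ), sub_zero]

/-- Vanishing on the variables gives vanishing on monomials by Leibniz. Locality passes from there
to power series, since a given coefficient of the image only sees finitely many monomials. -/
theorem CoeffLocal.derivation_eq_zero
    {T : Derivation ℝ (MvPowerSeries σ ℝ) (MvPowerSeries σ ℝ)}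
    (hT : CoeffLocal (T : MvPowerSeries σ ℝ →ₗ[ℝ] MvPowerSeries σ ℝ))
    (hX : ∀ c, T (MvPowerSeries.X c) = 0) : T = 0 := by
  classical
  ext a β
  obtain ⟨F, hF⟩ := hT β
  have hmon : ∀ γ, T (MvPowerSeries.monomial γ 1) = 0 := fun γ => by
    rw [derivation_monomial]
    exact Finset.sum_eq_zero fun c _ => by rw [hX, mul_zero, smul_zero]
  -- Subtracting the part of `a` supported on `F` removes every coefficient that the coefficient `β`
  -- of the image depends on.
  have h := hF (a - ∑ γ ∈ F, MvPowerSeries.coeff γ a • MvPowerSeries.monomial γ 1) fun γ hγ => by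
    rw [map_sub, map_sum, Finset.sum_eq_single γ]
    · simp
    · intro δ _ hne
      rw [MvPowerSeries.coeff_smul, MvPowerSeries.coeff_monomial_ne hne.symm, mul_zero]
    · exact fun h => absurd hγ h
  rw [map_sub, map_sum] at h
  simp only [Derivation.coeFn_coe, Derivation.map_smul, hmon, smul_zero, Finset.sum_const_zero,
    sub_zero] at h
  rw [h]
  simp

end Locality

theorem coeff_X_mul_ne_zero {σ : Type*} {c : σ} {β : σ →₀ ℕ} {a : MvPowerSeries σ ℝ}
    (h : MvPowerSeries.coeff β (MvPowerSeries.X c * a) ≠ 0) :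
    β c ≠ 0 ∧ MvPowerSeries.coeff (β - Finsupp.single c 1) a ≠ 0 := by
  classical
  refine ⟨fun h0 => h (coeff_X_mul_eq_zero h0 a), fun h0 => h ?_⟩
  rw [MvPowerSeries.X_def, MvPowerSeries.coeff_monomial_mul]
  split_ifs
  · rw [h0, mul_zero]
  · rfl

theorem miFactorial_add_e {I : Type*} (k : MI I) (n : I) :
    miFactorial (k + e n) = (k n + 1) * miFactorial k := by
  classical
  have h1 : miFactorial (k + e n) = ∏ i ∈ insert n k.support, ((k + e n) i)! := by
    refine Finsupp.prod_of_support_subset _ (fun i hi => ?_) _ (by simp)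
    by_cases h : i = n
    · simp [h]
    · have : k i ≠ 0 := by simpa [Finsupp.single_apply, Ne.symm h] using hi
      simp [this]
  have h2 : miFactorial k = ∏ i ∈ insert n k.support, (k i)! :=
    Finsupp.prod_of_support_subset _ (Finset.subset_insert _ _) _ (by simp)
  rw [h1, h2, ← Finset.mul_prod_erase _ _ (Finset.mem_insert_self n _),
    ← Finset.mul_prod_erase _ _ (Finset.mem_insert_self n _), ← mul_assoc]
  congr 1
  · simp [Nat.factorial_succ]
  · refine Finset.prod_congr rfl fun i hi => ?_
    simp [(Finset.ne_of_mem_erase hi).symm]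

theorem mi_induction {I : Type*} {P : MI I → Prop} (h0 : P 0) (hs : ∀ k n, P k → P (k + e n))
    (k : MI I) : P k := by
  suffices h : ∀ f, P f → P (f + k) by simpa using h 0 h0
  induction k using Finsupp.induction_linear with
  | zero => simp
  | add g g' hg hg' => exact fun f hf => by rw [← add_assoc]; exact hg' _ (hg _ hf)
  | single i b =>
    induction b with
    | zero => simp
    | succ b ih => exact fun f hf => by rw [Finsupp.single_add, ← add_assoc]; exact hs _ _ (ih f hf)

/-! ### The commuting derivations `D^(𝐧)` -/

namespace Setting

variable {d : ℕ} {L : Type*} (S : Setting d L)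

theorem SubcritPair.mono {S : Setting d L} {l : Option L} {k k' : MI (Idx d)}
    (h : S.SubcritPair (l, k)) (hk : k' ≤ k) : S.SubcritPair (l, k') :=
  ⟨h.1, fun k'' h0 h1 => h.2 k'' h0 (h1.trans hk)⟩

theorem subcritPair_zero (l : Option L) : S.SubcritPair (l, 0) :=
  ⟨S.regsol_lt l, fun _ h0 h1 => absurd (h0.trans_le h1) (lt_irrefl _)⟩

open scoped Classical in
theorem D_X_inl_eq (n : Idx d) (p : Option L × MI (Idx d)) :
    S.D n (MvPowerSeries.X (.inl p)) = if S.SubcritPair (p.1, p.2 + e n) then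
      (p.2 n + 1 : ℝ) • MvPowerSeries.X (.inl (p.1, p.2 + e n)) else 0 := by
  have h : S.D n (MvPowerSeries.X (.inl p)) = S.DTerm n p (MvPowerSeries.X (.inl p)) := by
    rw [D, Derivation.add_apply, MvPowerSeries.pderiv_X_of_ne (by simp), add_zero,
      sumDer_eq_sum _ _ _ {p}, Finset.sum_singleton]
    intro q hq
    unfold DTerm
    split_ifs
    · rw [Derivation.smul_apply, MvPowerSeries.pderiv_X_of_ne, smul_zero]
      simpa [eq_comm] using hq
    · simp
  rw [h]
  unfold DTerm
  split_ifs with hs <;> simp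

/-- A record of which coefficients of `a` enter: `∂_{𝗓_𝐧}` reads `β + e_𝐧`, and the other terms read
`β` with one factor `(𝔩,k+e_𝐧)` replaced by `(𝔩,k)`. Locality, the cut-off at `B` and the stability
of `𝒩⁻` all rest on it. -/
theorem coeff_D_eq_zero (n : Idx d) (a : PS d L) (β : MI (Coord d L))
    (h1 : MvPowerSeries.coeff (β + e (.inr n)) a = 0)
    (h2 : ∀ p, S.SubcritPair (p.1, p.2 + e n) → β (.inl (p.1, p.2 + e n)) ≠ 0 →
      MvPowerSeries.coeff (β - e (.inl (p.1, p.2 + e n)) + e (.inl p)) a = 0) :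
    MvPowerSeries.coeff β (S.D n a) = 0 := by
  rw [D, Derivation.add_apply, map_add, coeff_sumDer, MvPowerSeries.coeff_pderiv, h1, zero_mul,
    add_zero]
  refine finsum_eq_zero_of_forall_eq_zero fun p => ?_
  unfold DTerm
  split_ifs with hs
  · by_contra hne
    rw [Derivation.smul_apply, smul_eq_mul, smul_mul_assoc, map_smul] at hne
    obtain ⟨h3, h4⟩ := coeff_X_mul_ne_zero (right_ne_zero_of_smul hne)
    rw [MvPowerSeries.coeff_pderiv, h2 p hs h3, zero_mul] at h4
    exact h4 rfl
  · simp

theorem coeffLocal_D (n : Idx d) : CoeffLocal (S.D n : PS d L →ₗ[ℝ] PS d L) := by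
  classical
  intro β
  have hinj : Function.Injective
      (fun p : Option L × MI (Idx d) => (Sum.inl (p.1, p.2 + e n) : Coord d L)) := by
    rintro ⟨l, k⟩ ⟨l', k'⟩ h
    simpa using h
  refine ⟨insert (β + e (.inr n)) (((β.support.finite_toSet.preimage hinj.injOn).toFinset).image
    fun p => β - e (.inl (p.1, p.2 + e n)) + e (.inl p)), fun a ha => ?_⟩
  refine S.coeff_D_eq_zero n a β (ha _ (Finset.mem_insert_self _ _)) fun p _ hp =>
    ha _ (Finset.mem_insert_of_mem (Finset.mem_image_of_mem _ ?_))
  simpa using hp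

/-- Subcriticality passes to smaller `k`, so the condition on the intermediate pair follows from
that on the final one, which is symmetric in `n` and `m`; so is the product of the combinatorial
factors. -/
theorem D_D_X (n m : Idx d) (c : Coord d L) :
    S.D n (S.D m (MvPowerSeries.X c)) = S.D m (S.D n (MvPowerSeries.X c)) := by
  classical
  rcases c with p | u
  · have key : ∀ n m : Idx d, S.D n (S.D m (MvPowerSeries.X (.inl p))) =
        if S.SubcritPair (p.1, p.2 + e m + e n) then
          ((p.2 m + 1 : ℝ) * ((p.2 + e m) n + 1 : ℝ)) •
            (MvPowerSeries.X (.inl (p.1, p.2 + e m + e n)) : PS d L) else 0 := by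
      intro n m
      rw [D_X_inl_eq]
      by_cases h : S.SubcritPair (p.1, p.2 + e m + e n)
      · rw [if_pos (h.mono (by simp)), Derivation.map_smul, D_X_inl_eq, if_pos h, if_pos h,
          smul_smul]
      · rw [if_neg h]
        split_ifs
        · rw [Derivation.map_smul, D_X_inl_eq, if_neg h, smul_zero]
        · simp
    rw [key, key, add_right_comm]
    congr 2
    by_cases hnm : n = m
    · rw [hnm]
    · simp [hnm, Ne.symm hnm, mul_comm]
  · rcases S.D_X_inr n u with ⟨-, h⟩ | ⟨-, h⟩ <;> rcases S.D_X_inr m u with ⟨-, h'⟩ | ⟨-, h'⟩ <;>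
      simp [h, h']

theorem D_comm (n m : Idx d) (a : PS d L) : S.D n (S.D m a) = S.D m (S.D n a) := by
  have h : ⁅S.D n, S.D m⁆ = (0 : Derivation ℝ (PS d L) (PS d L)) := by
    refine CoeffLocal.derivation_eq_zero ?_ fun c => ?_
    · exact ((S.coeffLocal_D n).comp (S.coeffLocal_D m)).sub
        ((S.coeffLocal_D m).comp (S.coeffLocal_D n))
    · rw [Derivation.commutator_apply, D_D_X, sub_self]
  have := Derivation.congr_fun h a
  rwa [Derivation.commutator_apply, Derivation.zero_apply, sub_eq_zero] at this

/-- `D^(𝐧)` as an endomorphism. -/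
abbrev DEnd (n : Idx d) : Module.End ℝ (PS d L) := (S.D n : PS d L →ₗ[ℝ] PS d L)

/-- The algebra generated by the commuting derivations `D^(𝐧)`. -/
abbrev DAlg : Subalgebra ℝ (Module.End ℝ (PS d L)) := Algebra.adjoin ℝ (Set.range S.DEnd)

/-- Allows unordered products over multi-indices inside the noncommutative algebra of endomorphisms.
-/
instance : CommMonoid S.DAlg :=
  { (inferInstance : Monoid S.DAlg) with
    mul_comm := fun a b => by
      have := Algebra.isMulCommutative_adjoin ℝ (s := Set.range S.DEnd) (by
        rintro _ ⟨n, rfl⟩ _ ⟨m, rfl⟩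
        exact LinearMap.ext fun a => S.D_comm n m a)
      exact this.is_comm.comm a b }

/-- The composition `∏ (D^(𝐧))^{k(𝐧)}`. -/
def Dpow (k : MI (Idx d)) : Module.End ℝ (PS d L) :=
  ((k.prod fun n a => (⟨S.DEnd n, Algebra.subset_adjoin ⟨n, rfl⟩⟩ : S.DAlg) ^ a : S.DAlg) :
    Module.End ℝ (PS d L))

theorem Dpow_zero : S.Dpow 0 = 1 := by
  simp [Dpow]

theorem Dpow_add (k k' : MI (Idx d)) : S.Dpow (k + k') = S.Dpow k * S.Dpow k' := by
  rw [Dpow, Finsupp.prod_add_index' (by simp) (by intros; rw [pow_add])]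
  rfl

theorem Dpow_e (n : Idx d) : S.Dpow (e n) = S.DEnd n := by
  rw [Dpow, Finsupp.prod_single_index (by simp), pow_one]

theorem prod_map_DEnd (l : List (Idx d)) : (l.map S.DEnd).prod = S.Dpow (l.map e).sum := by
  induction l with
  | nil => simp [Dpow_zero]
  | cons n l ih => rw [List.map_cons, List.prod_cons, ih, List.map_cons, List.sum_cons, Dpow_add,
      Dpow_e]

-- The factor `k!` is what cancels the `1/k!` of the exponential in Part 2.
open scoped Classical in
theorem Dpow_X_inl_zero (l : Option L) (k : MI (Idx d)) :
    S.Dpow k (MvPowerSeries.X (.inl (l, 0))) =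
      if S.SubcritPair (l, k) then (miFactorial k : ℝ) • MvPowerSeries.X (.inl (l, k)) else 0 := by
  induction k using mi_induction with
  | h0 => simp [Dpow_zero, S.subcritPair_zero l, miFactorial]
  | hs k n ih =>
    rw [add_comm k, Dpow_add, Dpow_e, Module.End.mul_apply, ih, add_comm (e n)]
    by_cases h : S.SubcritPair (l, k + e n)
    · rw [if_pos (h.mono (by simp)), if_pos h, map_smul, Derivation.coeFn_coe, D_X_inl_eq,
        if_pos h, smul_smul, miFactorial_add_e, mul_comm]
      push_cast
      rfl
    · rw [if_neg h]
      split_ifs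
      · rw [map_smul, Derivation.coeFn_coe, D_X_inl_eq, if_neg h, smul_zero]
      · simp

/-! ### Normal ordering -/

/-- The map `∑ₖ cₖ 𝖷^k ↦ ∑ₖ cₖ D^k π`, evaluating a polynomial in the symbols of the commuting
derivations with all multiplications to the left. -/
def normalOrder (π : PS d L) : MvPolynomial (Idx d) (PS d L) →ₗ[PS d L] PS d L :=
  (MvPolynomial.basisMonomials (Idx d) (PS d L)).constr (PS d L) fun k => S.Dpow k π

theorem normalOrder_monomial (π : PS d L) (k : MI (Idx d)) (c : PS d L) :
    S.normalOrder π (MvPolynomial.monomial k c) = c * S.Dpow k π := by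
  have h := (MvPolynomial.basisMonomials (Idx d) (PS d L)).constr_basis (PS d L)
    (fun k => S.Dpow k π) k
  rw [MvPolynomial.coe_basisMonomials] at h
  rw [← mul_one c, ← smul_eq_mul c 1, ← MvPolynomial.smul_monomial, map_smul, normalOrder, h]
  simp

/-- Because the derivations commute, those of the monomial may be applied to `π` first. Multiplying
symbols by `𝗓^J 𝖷^J` thus corresponds to multiplying by `𝗓^J` on the left and applying `D^J` on the
right. -/
theorem normalOrder_monomial_mul (π : PS d L) (k : MI (Idx d)) (c : PS d L)
    (p : MvPolynomial (Idx d) (PS d L)) :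
    S.normalOrder π (MvPolynomial.monomial k c * p) = c * S.normalOrder (S.Dpow k π) p := by
  induction p using MvPolynomial.induction_on' with
  | monomial k' c' =>
    rw [MvPolynomial.monomial_mul, normalOrder_monomial, normalOrder_monomial, add_comm k,
      Dpow_add, Module.End.mul_apply, mul_assoc]
  | add p q hp hq => rw [mul_add, map_add, map_add, hp, hq, mul_add]

theorem normalOrder_eq_sum (π : PS d L) (p : MvPolynomial (Idx d) (PS d L)) :
    S.normalOrder π p = ∑ k ∈ p.support, p.coeff k * S.Dpow k π := by
  conv_lhs => rw [← p.support_sum_monomial_coeff]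
  rw [map_sum]
  exact Finset.sum_congr rfl fun k _ => S.normalOrder_monomial _ _ _

/-- The symbols all of whose coefficients vanish at and below `β`. -/
abbrev symbolIdeal (β : MI (Coord d L)) : Ideal (MvPolynomial (Idx d) (PS d L)) :=
  (belowIdeal β).map MvPolynomial.C

theorem coeff_normalOrder_eq_zero {β : MI (Coord d L)} {p : MvPolynomial (Idx d) (PS d L)}
    (hp : p ∈ symbolIdeal β) (π : PS d L) :
    MvPowerSeries.coeff β (S.normalOrder π p) = 0 := by
  rw [normalOrder_eq_sum, map_sum]
  refine Finset.sum_eq_zero fun k _ => ?_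
  have := MvPolynomial.mem_map_C_iff.1 hp k
  exact (belowIdeal β).mul_mem_right _ this β le_rfl

/-- After normal ordering no derivation hits the coefficients any more, so they may be changed
modulo an ideal that the derivations do not preserve. -/
theorem coeff_normalOrder_congr {β : MI (Coord d L)} {p q : MvPolynomial (Idx d) (PS d L)}
    (hp : p - q ∈ symbolIdeal β) (π : PS d L) :
    MvPowerSeries.coeff β (S.normalOrder π p) = MvPowerSeries.coeff β (S.normalOrder π q) := by
  rw [← sub_eq_zero, ← map_sub, ← map_sub]
  exact S.coeff_normalOrder_eq_zero hp π

end Setting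

/-- Induction by left multiplication with Lie algebra elements, the form in which `graft` is
recursive. -/
theorem universalEnvelopingAlgebra_induction {R 𝔤 : Type*} [CommRing R] [LieRing 𝔤]
    [LieAlgebra R 𝔤] {P : UniversalEnvelopingAlgebra R 𝔤 → Prop} (one : P 1)
    (ι_mul : ∀ X u, P u → P (UniversalEnvelopingAlgebra.ι R X * u))
    (add : ∀ u v, P u → P v → P (u + v)) (smul : ∀ (r : R) u, P u → P (r • u))
    (u : UniversalEnvelopingAlgebra R 𝔤) : P u := by
  -- The strengthened claim is multiplicative in `u`, so it can be checked by the induction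
  -- principle of the tensor algebra.
  suffices h : ∀ v, P v → P (u * v) by simpa using h 1 one
  obtain ⟨x, rfl⟩ : ∃ x, UniversalEnvelopingAlgebra.mkAlgHom R 𝔤 x = u :=
    RingCon.mkₐ_surjective (α := R) (UniversalEnvelopingAlgebra.ringCon R 𝔤) u
  induction x using TensorAlgebra.induction with
  | algebraMap r =>
    intro v hv
    rw [AlgHom.commutes, ← Algebra.smul_def]
    exact smul r v hv
  | ι X => exact fun v hv => ι_mul X v hv
  | mul x y hx hy =>
    intro v hv
    rw [map_mul, mul_assoc]
    exact hx _ (hy v hv)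
  | add x y hx hy =>
    intro v hv
    rw [map_add, add_mul]
    exact add _ _ (hx v hv) (hy v hv)

/-! ### Normal-ordered form of the action of `𝖣_(J,𝐦)` -/

namespace Setting

variable {d : ℕ} {L : Type*} (S : Setting d L)

attribute [local instance 100] LieRing.ofAssociativeRing

theorem rho_ι (X : S.lie) (π : PS d L) :
    S.rho (UniversalEnvelopingAlgebra.ι ℝ X) π = (X : Derivation ℝ (PS d L) (PS d L)) π := by
  rw [rho, UniversalEnvelopingAlgebra.lift_ι_apply]
  rfl

/-- Under `ρ` the recursion for `graft` becomes `X(w · v) - (X w) · v = w · X v`, with `v = ρ(u)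
D^(𝐧) π`. So grafting multiplies on the left and differentiates on the right, whatever `u` stands in
between. -/
theorem rho_graft (n : Idx d) (u : S.U) (w : S.W) (π : PS d L) :
    S.rho (S.graft n u w) π = w * S.rho u (S.D n π) := by
  induction u using universalEnvelopingAlgebra_induction generalizing w with
  | one => rw [graft_one, rho_ι, map_one]; rfl
  | ι_mul X u ih =>
    rw [graft_mul, map_sub, map_mul, map_mul, LinearMap.sub_apply, Module.End.mul_apply,
      Module.End.mul_apply, ih, ih, rho_ι, rho_ι, Derivation.leibniz, smul_eq_mul, smul_eq_mul]
    have : ((S.act X w : S.W) : PS d L) = (X : Derivation ℝ (PS d L) (PS d L)) w := rfl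
    rw [this]
    ring
  | add u v hu hv =>
    have : S.graft n (u + v) w = S.graft n u w + S.graft n v w := by simp [graft]
    rw [this, map_add, map_add, LinearMap.add_apply, LinearMap.add_apply, hu, hv, mul_add]
  | smul r u hu =>
    have : S.graft n (r • u) w = r • S.graft n u w := by simp [graft]
    rw [this, map_smul, map_smul, LinearMap.smul_apply, LinearMap.smul_apply, hu, mul_smul_comm]

theorem rho_foldr_graft (l : List S.M) (u : S.U) (π : PS d L) :
    S.rho (l.foldr (fun p u => S.graft p.2 u (S.zN p.1)) u) π =
      (l.map fun p => zmon p.1.1).prod * S.rho u (S.Dpow (l.map fun p => e p.2).sum π) := by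
  induction l generalizing π with
  | nil => simp [Dpow_zero]
  | cons p l ih =>
    rw [List.foldr_cons, rho_graft, ih, List.map_cons, List.map_cons, List.prod_cons,
      List.sum_cons, add_comm (e p.2), Dpow_add, Dpow_e, mul_assoc]
    rfl

/-- The operator `𝛛^𝐦`. -/
def delPow (m : Idx d) : Module.End ℝ (PS d L) :=
  (List.ofFn fun i => ((S.del i : PS d L →ₗ[ℝ] PS d L) : Module.End ℝ (PS d L)) ^ m i).prod

theorem rho_prod_lieDel (m : Idx d) :
    S.rho (List.ofFn fun i => UniversalEnvelopingAlgebra.ι ℝ (S.lieDel i) ^ m i).prod =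
      S.delPow m := by
  rw [map_list_prod, List.map_ofFn, delPow]
  congr 2
  funext i
  rw [Function.comp_apply, map_pow]
  congr 1
  exact LinearMap.ext fun π => S.rho_ι _ π

/-- The product `∏ 𝗓^γ` over a multi-index in the pairs `(γ, 𝐧)`. -/
def jetMon (J : MI S.Mminus) : PS d L := J.prod fun q a => zmon q.1.1.1 ^ a

/-- The multi-index `∑ e_𝐧` over a multi-index in the pairs `(γ, 𝐧)`. -/
def jetIdx (J : MI S.Mminus) : MI (Idx d) := J.sum fun q a => a • e q.1.2

/-- After the action, the factors `𝗓^γ` and `D^(𝐧)` each commute among themselves, so the order in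
which the grafts were listed is irrelevant. -/
theorem rho_Dbasis (J : MI S.Mminus) (m : Idx d) (π : PS d L) :
    S.rho (S.Dbasis (J.mapDomain Subtype.val) m) π =
      ((miFactorial J * idxFactorial m : ℕ) : ℝ)⁻¹ •
        (S.jetMon J * S.delPow m (S.Dpow (S.jetIdx J) π)) := by
  classical
  have h1 : miFactorial (J.mapDomain Subtype.val) = miFactorial J :=
    Finsupp.prod_mapDomain_index_inj Subtype.val_injective
  have h2 : ((Finsupp.toMultiset (J.mapDomain Subtype.val)).toList.map
      fun p : S.M => (zmon p.1.1 : PS d L)).prod = S.jetMon J := by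
    rw [← Multiset.prod_coe, ← Multiset.map_coe, Multiset.coe_toList, Finsupp.toMultiset_map,
      Finsupp.prod_toMultiset, Finsupp.prod_mapDomain_index (by simp) (by intros; rw [pow_add]),
      Finsupp.prod_mapDomain_index (by simp) (by intros; rw [pow_add])]
    rfl
  have h3 : ((Finsupp.toMultiset (J.mapDomain Subtype.val)).toList.map
      fun p : S.M => e p.2).sum = S.jetIdx J := by
    rw [← Multiset.sum_coe, ← Multiset.map_coe, Multiset.coe_toList, Finsupp.toMultiset_map,
      Finsupp.sum_toMultiset, Finsupp.sum_mapDomain_index (by simp) (by intros; rw [add_smul]),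
      Finsupp.sum_mapDomain_index (by simp) (by intros; rw [add_smul])]
    rfl
  rw [Dbasis, map_smul, LinearMap.smul_apply, rho_foldr_graft, rho_prod_lieDel, h1, h2, h3]

theorem Char.val_eq {S : Setting d L} (f : S.Char) (J : MI S.Mminus) (m : Idx d) :
    f.val J m = (J.prod fun q a => f (MvPolynomial.X (.inl q)) ^ a) *
      ∏ i, f (MvPolynomial.X (.inr i)) ^ m i := by
  simp [Char.val, Finsupp.prod, map_prod]

theorem Char.gammaTerm_apply {S : Setting d L} (f : S.Char) (J : MI S.Mminus) (m : Idx d)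
    (π : PS d L) : f.gammaTerm (J, m) π =
      (f.val J m * ((miFactorial J : ℝ)⁻¹ * (idxFactorial m : ℝ)⁻¹)) •
        (S.jetMon J * S.delPow m (S.Dpow (S.jetIdx J) π)) := by
  rw [gammaTerm, LinearMap.smul_apply, rho_Dbasis, smul_smul, Nat.cast_mul, mul_inv]

theorem Char.expTerm_eq {S : Setting d L} (f : S.Char) {l : ℕ} (ν : Fin l → Idx d) (π : PS d L) :
    f.expTerm ν π =
      S.normalOrder π (∏ j, MvPolynomial.monomial (e (ν j)) (f.series (ν j))) := by
  have h : (List.ofFn fun j => ((S.D (ν j) : PS d L →ₗ[ℝ] PS d L) :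
      Module.End ℝ (PS d L))).reverse.prod = S.Dpow (∑ j, e (ν j)) := by
    have h1 : (List.ofFn fun j => ((S.D (ν j) : PS d L →ₗ[ℝ] PS d L) :
      Module.End ℝ (PS d L))) = (List.ofFn ν).map S.DEnd := by
      rw [List.map_ofFn]; rfl
    rw [h1, ← List.map_reverse, prod_map_DEnd, List.map_reverse, List.sum_reverse, List.map_ofFn,
      List.sum_ofFn]
    rfl
  have h2 : ∀ s : Finset (Fin l), ∏ j ∈ s, MvPolynomial.monomial (e (ν j)) (f.series (ν j)) =
      MvPolynomial.monomial (∑ j ∈ s, e (ν j)) (∏ j ∈ s, f.series (ν j)) := fun s =>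
    (MvPolynomial.monomial_sum_prod ..).symm
  rw [h2, normalOrder_monomial, expTerm, h]

end Setting

/-! ### Stabilisation of coefficients and a binomial identity -/

section GeneralLemmas

theorem MvPolynomial.coeff_pow_eq_zero {σ R : Type*} [CommRing R] {p : MvPolynomial σ R}
    (hp : MvPolynomial.constantCoeff p = 0) (l : ℕ) (m : σ →₀ ℕ) (hm : m.degree < l) :
    (p ^ l).coeff m = 0 := by
  classical
  induction l generalizing m with
  | zero => exact absurd hm (Nat.not_lt_zero _)
  | succ l ih =>
    rw [pow_succ, MvPolynomial.coeff_mul]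
    refine Finset.sum_eq_zero fun x hx => ?_
    by_cases h0 : x.2 = 0
    · rw [h0, ← MvPolynomial.constantCoeff_eq, hp, mul_zero]
    · rw [ih x.1, zero_mul]
      rw [← Finset.HasAntidiagonal.mem_antidiagonal.1 hx, map_add] at hm
      have : x.2.degree ≠ 0 := fun h => h0 ((Finsupp.degree_eq_zero_iff _).1 h)
      omega

/-- Without constant term, the `l`-th power has no coefficient of degree below `l`; the coefficient
of degree `|m|` is therefore final from order `|m| + 1` on. -/
theorem MvPolynomial.coeff_truncExp {σ R : Type*} [CommRing R] [Algebra ℝ R]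
    {p : MvPolynomial σ R} (hp : MvPolynomial.constantCoeff p = 0) (m : σ →₀ ℕ) {M : ℕ}
    (hM : m.degree < M) :
    (truncExp M p).coeff m = (truncExp (m.degree + 1) p).coeff m := by
  rw [truncExp, truncExp, ← Finset.sum_sdiff (Finset.range_subset_range.2 hM),
    MvPolynomial.coeff_add, MvPolynomial.coeff_sum, Finset.sum_eq_zero, zero_add]
  intro l hl
  simp only [Finset.mem_sdiff, Finset.mem_range, not_lt] at hl
  rw [MvPolynomial.coeff_smul, MvPolynomial.coeff_pow_eq_zero hp l m (by omega), smul_zero]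

/-- The comparison of coefficients behind the differential equation for `shiftSymbol`: the factor `u
i + 1` comes from `∂_{𝗍ᵢ}`, the factor `(n + u) i + 1` from `𝛛ᵢ 𝗓_{𝐧+𝐮}`. -/
theorem idxChoose_add_unitIdx {d : ℕ} (n u : Idx d) (i : Fin d) :
    idxChoose (n + (u + unitIdx i)) n * (u i + 1) = idxChoose (n + u) n * ((n + u) i + 1) := by
  classical
  rw [idxChoose, idxChoose, ← Finset.mul_prod_erase _ _ (Finset.mem_univ i),
    ← Finset.mul_prod_erase _ _ (Finset.mem_univ i), mul_right_comm,
    mul_right_comm _ _ ((n + u) i + 1)]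
  congr 1
  · have h := Nat.add_one_mul_choose_eq (n i + u i) (u i)
    have h2 : (n i + u i).choose (n i) = (n i + u i).choose (u i) := Nat.choose_symm_add
    have h3 : (n i + (u i + 1)).choose (n i) = (n i + (u i + 1)).choose (u i + 1) :=
      Nat.choose_symm_add
    simp only [Pi.add_apply, unitIdx, Pi.single_eq_same]
    rw [h2, h3, mul_comm ((n i + u i).choose _)]
    exact h.symm
  · refine Finset.prod_congr rfl fun j hj => ?_
    simp [unitIdx, Pi.single_eq_of_ne (Finset.ne_of_mem_erase hj)]

theorem idxChoose_self {d : ℕ} (n : Idx d) : idxChoose n n = 1 := by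
  simp [idxChoose]

end GeneralLemmas

/-- The finitely supported function with given values on a finite type. -/
abbrev toMI {d : ℕ} (m : Idx d) : MI (Fin d) := Finsupp.equivFunOnFinite.symm m

theorem toMI_zero {d : ℕ} : toMI (0 : Idx d) = 0 := by
  ext
  rfl

theorem toMI_add_unitIdx {d : ℕ} (m : Idx d) (i : Fin d) :
    toMI (m + unitIdx i) = toMI m + Finsupp.single i 1 := by
  classical
  ext j
  simp [unitIdx, Finsupp.single_apply, Pi.single_apply, eq_comm]

/-! ### The symbol of `𝛛^𝐦` from a generating function -/

namespace Setting

variable {d : ℕ} {L : Type*} (S : Setting d L)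

/-- The multi-index only involves coordinates `𝐧 ≤ B`. -/
def PolyBounded (B : Idx d) (β : MI (Coord d L)) : Prop := ∀ n, β (.inr n) ≠ 0 → n ≤ B

/-- The two power series agree in all coefficients that only involve coordinates `𝐧 ≤ B`. -/
def Agree (B : Idx d) (a b : PS d L) : Prop :=
  ∀ β, PolyBounded B β → MvPowerSeries.coeff β a = MvPowerSeries.coeff β b

open scoped Classical in
/-- The coordinate `𝗓_𝐧` if `𝐧 ≤ B`, and zero otherwise. -/
def polyVar (B n : Idx d) : PS d L := if n ≤ B then MvPowerSeries.X (.inr n) else 0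

theorem polyVar_of_not_le {B n : Idx d} (h : ¬ n ≤ B) : (polyVar B n : PS d L) = 0 := if_neg h

/-- The derivation `𝛛ᵢ` with all coordinates `𝗓_𝐧` with `𝐧 ≰ B` set to zero. -/
def delTrunc (B : Idx d) (i : Fin d) : Derivation ℝ (PS d L) (PS d L) :=
  ∑ n ∈ Finset.Iic B, ((n i + 1 : ℝ) • polyVar B (n + unitIdx i) : PS d L) • S.D n

theorem delTrunc_apply (B : Idx d) (i : Fin d) (a : PS d L) : S.delTrunc B i a =
    ∑ n ∈ Finset.Iic B, ((n i + 1 : ℝ) • polyVar B (n + unitIdx i) : PS d L) * S.D n a := by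
  rw [delTrunc, ← Derivation.coeFnAddMonoidHom_apply, map_sum, Finset.sum_apply]
  rfl

/-- The cut-off is consistent: if `m ≰ B` then `m + eᵢ ≰ B` as well, and both sides vanish. -/
theorem delTrunc_polyVar (B : Idx d) (i : Fin d) (m : Idx d) :
    S.delTrunc B i (polyVar B m) = (m i + 1 : ℝ) • (polyVar B (m + unitIdx i) : PS d L) := by
  classical
  by_cases h : m ≤ B
  · rw [delTrunc_apply, Finset.sum_eq_single m]
    · rcases S.D_X_inr m m with ⟨-, h'⟩ | ⟨h', -⟩
      · rw [polyVar, polyVar, if_pos h, h', mul_one]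
      · exact absurd rfl h'
    · intro n _ hne
      rcases S.D_X_inr n m with ⟨h', -⟩ | ⟨-, h'⟩
      · exact absurd h'.symm hne
      · rw [polyVar, polyVar, if_pos h, h', mul_zero]
    · exact fun h' => absurd (Finset.mem_Iic.2 h) h'
  · rw [polyVar_of_not_le h, map_zero, polyVar_of_not_le, smul_zero]
    exact fun h' => h ((le_add_of_nonneg_right zero_le).trans h')

/-- At a multi-index bounded by `B`, the factor `𝗓_{𝐧+eᵢ}` forces `𝐧 + eᵢ ≤ B`, hence `𝐧 ≤ B`; and
then `D^(𝐧)` only reads coefficients that are again bounded by `B`. So the cut-off may be iterated.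
-/
theorem agree_del {B : Idx d} {a b : PS d L} (h : Agree B a b) (i : Fin d) :
    Agree B (S.del i a) (S.delTrunc B i b) := by
  classical
  intro β hβ
  have hle : ∀ n : Idx d, n ≤ n + unitIdx i := fun n => le_add_of_nonneg_right zero_le
  rw [del, coeff_sumDer, delTrunc_apply, map_sum, finsum_eq_sum_of_support_subset (s := Finset.Iic B)]
  · refine Finset.sum_congr rfl fun n hn => ?_
    rw [dTerm, Derivation.smul_apply, smul_eq_mul, smul_mul_assoc, smul_mul_assoc, map_smul,
      map_smul]
    congr 1
    rw [polyVar]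
    split_ifs with hB
    · rw [← sub_eq_zero, ← map_sub, ← mul_sub, ← map_sub]
      by_contra hne
      refine (coeff_X_mul_ne_zero hne).2 (S.coeff_D_eq_zero n _ _ ?_ fun p _ _ => ?_)
      · rw [map_sub, sub_eq_zero]
        refine h _ fun m hm => ?_
        by_cases hnm : n = m
        · exact hnm ▸ Finset.mem_Iic.1 hn
        · refine hβ m fun h0 => hm ?_
          simp [hnm, h0]
      · rw [map_sub, sub_eq_zero]
        refine h _ fun m hm => hβ m fun h0 => hm ?_
        simp [h0]
    · rw [zero_mul, map_zero]
      by_contra hne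
      exact hB (hβ _ (coeff_X_mul_ne_zero hne).1)
  · intro n hn
    rw [Function.mem_support, dTerm, Derivation.smul_apply, smul_eq_mul, smul_mul_assoc,
      map_smul] at hn
    exact Finset.mem_coe.2 (Finset.mem_Iic.2
      ((hle n).trans (hβ _ (coeff_X_mul_ne_zero (right_ne_zero_of_smul hn)).1)))

/-- The symbol of the truncated derivation `𝛛ᵢ`. -/
def delSymbol (B : Idx d) (i : Fin d) : MvPolynomial (Idx d) (PS d L) :=
  ∑ n ∈ Finset.Iic B, MvPolynomial.monomial (e n) ((n i + 1 : ℝ) • polyVar B (n + unitIdx i))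

/-- Leibniz on `c D^k π`: either `c` is differentiated, or one further `D^(𝐧)` joins `D^k`, which is
multiplication by the symbol. -/
theorem delTrunc_normalOrder (B : Idx d) (i : Fin d) (π : PS d L)
    (p : MvPolynomial (Idx d) (PS d L)) : S.delTrunc B i (S.normalOrder π p) =
      S.normalOrder π (coeffDer (S.delTrunc B i) p + delSymbol B i * p) := by
  induction p using MvPolynomial.induction_on' with
  | monomial k c =>
    rw [normalOrder_monomial, Derivation.leibniz, smul_eq_mul, smul_eq_mul, coeffDer_monomial,
      delSymbol, Finset.sum_mul, map_add, map_sum, normalOrder_monomial, delTrunc_apply,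
      add_comm, mul_comm (S.Dpow k π), Finset.mul_sum]
    congr 1
    refine Finset.sum_congr rfl fun n _ => ?_
    rw [MvPolynomial.monomial_mul, normalOrder_monomial, Dpow_add, Module.End.mul_apply, Dpow_e,
      Derivation.coeFn_coe]
    ring
  | add p q hp hq =>
    rw [(coeffDer (S.delTrunc B i)).map_add p q, mul_add, add_add_add_comm,
      (S.normalOrder π).map_add p q, (S.delTrunc B i).map_add, hp, hq, ← (S.normalOrder π).map_add]

/-- The symbol `∑ₙ ∑_{𝐮 ≠ 0} binom(𝐧+𝐮,𝐧) 𝗍^𝐮 𝗓_{𝐧+𝐮} 𝖷_𝐧`, truncated. -/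
def shiftSymbol (B : Idx d) : MvPolynomial (Fin d) (MvPolynomial (Idx d) (PS d L)) :=
  ∑ n ∈ Finset.Iic B, ∑ u ∈ (Finset.Iic B).erase 0, MvPolynomial.monomial (toMI u)
    (MvPolynomial.monomial (e n) ((idxChoose (n + u) n : ℝ) • polyVar B (n + u)))

theorem constantCoeff_shiftSymbol (B : Idx d) :
    MvPolynomial.constantCoeff (shiftSymbol B :
      MvPolynomial (Fin d) (MvPolynomial (Idx d) (PS d L))) = 0 := by
  classical
  rw [shiftSymbol, map_sum]
  refine Finset.sum_eq_zero fun n _ => ?_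
  rw [map_sum]
  refine Finset.sum_eq_zero fun u hu => ?_
  rw [MvPolynomial.constantCoeff_eq, MvPolynomial.coeff_monomial, if_neg]
  intro h
  refine (Finset.mem_erase.1 hu).1 (funext fun i => ?_)
  exact DFunLike.congr_fun h i

/-- The differential equation `∂_{𝗍ᵢ} H = 𝛛ᵢ H + σᵢ`. It holds exactly for the truncated objects,
since the cut-off at `B` is compatible with the shift of `𝐮` by `eᵢ`. -/
theorem pderiv_shiftSymbol (B : Idx d) (i : Fin d) :
    MvPolynomial.pderiv i (shiftSymbol B) =
      coeffDer (coeffDer (S.delTrunc B i)) (shiftSymbol B) +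
        MvPolynomial.C (delSymbol B i) := by
  classical
  have hle : ∀ n : Idx d, n ≤ n + unitIdx i := fun n => le_add_of_nonneg_right zero_le
  have h1 : MvPolynomial.pderiv i (shiftSymbol B) = ∑ n ∈ Finset.Iic B, ∑ u ∈ Finset.Iic B,
      MvPolynomial.monomial (toMI u - Finsupp.single i 1) (MvPolynomial.monomial (e n)
        (((idxChoose (n + u) n * u i : ℕ) : ℝ) • (polyVar B (n + u) : PS d L))) := by
    rw [shiftSymbol, map_sum]
    refine Finset.sum_congr rfl fun n _ => ?_
    -- The term `u = 0`, absent from `H`, may be added since it carries the factor `u i = 0`.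
    rw [map_sum, ← Finset.add_sum_erase (Finset.Iic B) _ (Finset.mem_Iic.2 zero_le)]
    simp only [Pi.zero_apply, mul_zero, Nat.cast_zero, zero_smul, map_zero, zero_add]
    refine Finset.sum_congr rfl fun u _ => ?_
    rw [MvPolynomial.pderiv_monomial, Nat.cast_mul, mul_comm, ← nsmul_eq_mul, mul_smul,
      smul_comm, ← map_nsmul, ← Nat.cast_smul_eq_nsmul ℝ]
    rfl
  have h2 : coeffDer (coeffDer (S.delTrunc B i)) (shiftSymbol B) +
      MvPolynomial.C (delSymbol B i) = ∑ n ∈ Finset.Iic B, ∑ u ∈ Finset.Iic B,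
      MvPolynomial.monomial (toMI u) (MvPolynomial.monomial (e n)
        (((idxChoose (n + u) n * ((n + u) i + 1) : ℕ) : ℝ) •
          (polyVar B (n + u + unitIdx i) : PS d L))) := by
    rw [shiftSymbol, delSymbol, map_sum, map_sum, ← Finset.sum_add_distrib]
    refine Finset.sum_congr rfl fun n _ => ?_
    -- Here the missing term `u = 0` is supplied by the symbol of `𝛛ᵢ`, because `binom(𝐧,𝐧) = 1`.
    rw [map_sum, ← Finset.add_sum_erase (Finset.Iic B) _ (Finset.mem_Iic.2 zero_le), add_comm]
    congr 1
    · rw [add_zero, idxChoose_self, one_mul]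
      rw [toMI_zero, MvPolynomial.C_apply]
      push_cast
      rfl
    · refine Finset.sum_congr rfl fun u _ => ?_
      rw [coeffDer_monomial, coeffDer_monomial, Derivation.map_smul, delTrunc_polyVar, smul_smul]
      push_cast
      rfl
  rw [h1, h2]
  refine Finset.sum_congr rfl fun n _ => ?_
  -- Only `u i ≠ 0` contributes on the left and only `u + eᵢ ≤ B` on the right; the shift by `eᵢ` is
  -- a bijection between these two ranges.
  rw [← Finset.sum_filter_of_ne (s := Finset.Iic B) (p := fun u => u i ≠ 0),
    ← Finset.sum_filter_of_ne (s := Finset.Iic B) (p := fun u => u + unitIdx i ≤ B)]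
  · have hsub : ∀ u : Idx d, u i ≠ 0 → u - unitIdx i + unitIdx i = u := fun u hu => by
      refine tsub_add_cancel_of_le fun j => ?_
      by_cases hj : j = i
      · subst hj
        simpa [unitIdx, Nat.one_le_iff_ne_zero] using hu
      · simp [unitIdx, Pi.single_eq_of_ne hj]
    refine Finset.sum_nbij' (fun u => u - unitIdx i) (fun u => u + unitIdx i) ?_ ?_ ?_ ?_ ?_
    · intro u hu
      rw [Finset.mem_filter, Finset.mem_Iic] at hu ⊢
      exact ⟨tsub_le_self.trans hu.1, by rw [hsub u hu.2]; exact hu.1⟩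
    · intro u hu
      rw [Finset.mem_filter, Finset.mem_Iic] at hu ⊢
      exact ⟨hu.2, by simp [unitIdx]⟩
    · exact fun u hu => hsub u (Finset.mem_filter.1 hu).2
    · exact fun u _ => add_tsub_cancel_right u _
    · intro u hu
      obtain ⟨v, hv⟩ : ∃ v, u = v + unitIdx i := ⟨_, (hsub u (Finset.mem_filter.1 hu).2).symm⟩
      rw [hv, add_tsub_cancel_right, toMI_add_unitIdx, add_tsub_cancel_right,
        ← idxChoose_add_unitIdx, add_assoc]
      simp [unitIdx]
  · intro u _ hne
    by_contra h
    refine hne ?_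
    rw [polyVar_of_not_le, smul_zero, map_zero, map_zero]
    intro h'
    refine h (le_trans ?_ h')
    rw [add_assoc]
    exact le_add_of_nonneg_left zero_le
  · intro u _ hne h
    exact hne (by rw [h]; simp)

/-- The symbol of `𝛛^𝐦 / 𝐦!`, truncated. -/
def delPowSymbol (B m : Idx d) : MvPolynomial (Idx d) (PS d L) :=
  (truncExp ((toMI m).degree + 1) (shiftSymbol B)).coeff (toMI m)

theorem delPowSymbol_eq (B m : Idx d) {M : ℕ} (hM : (toMI m).degree < M) :
    (truncExp M (shiftSymbol B)).coeff (toMI m) = (delPowSymbol B m :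
      MvPolynomial (Idx d) (PS d L)) :=
  MvPolynomial.coeff_truncExp (constantCoeff_shiftSymbol B) _ hM

theorem delPowSymbol_zero (B : Idx d) :
    (delPowSymbol B 0 : MvPolynomial (Idx d) (PS d L)) = 1 := by
  simp [delPowSymbol, toMI_zero, truncExp]

/-- The coefficient of `𝗍^𝐦` in `∂_{𝗍ᵢ} exp H = (𝛛ᵢ + σᵢ) exp H`. -/
theorem delPowSymbol_add_unitIdx (B m : Idx d) (i : Fin d) :
    (m i + 1 : ℝ) • delPowSymbol B (m + unitIdx i) =
      coeffDer (S.delTrunc B i) (delPowSymbol B m) + delSymbol B i * delPowSymbol B m := by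
  set H : MvPolynomial (Fin d) (MvPolynomial (Idx d) (PS d L)) := shiftSymbol B with hH
  set M := (toMI m).degree + 1 with hM
  -- Both derivations lower the truncation from `M + 1` to `M` in the same way, so the lost term
  -- cancels and the equation for `exp H` is exact in degree `𝐦`.
  have h1 := derivation_truncExp_succ ((MvPolynomial.pderiv i).restrictScalars ℝ) M H
  have h2 := derivation_truncExp_succ (coeffDer (coeffDer (S.delTrunc B i))) M H
  rw [Derivation.restrictScalars_apply, Derivation.restrictScalars_apply, hH, S.pderiv_shiftSymbol,
    ← hH, mul_add, ← h2, mul_comm _ (MvPolynomial.C _)] at h1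
  have h3 := congrArg (MvPolynomial.coeff (toMI m)) h1
  rw [MvPolynomial.coeff_add, coeff_coeffDer, MvPolynomial.coeff_C_mul,
    MvPolynomial.coeff_pderiv, ← toMI_add_unitIdx, delPowSymbol_eq B m (by omega),
    delPowSymbol_eq B m (by omega), delPowSymbol_eq] at h3
  · rw [← h3, mul_comm, Algebra.smul_def]
    simp
  · rw [toMI_add_unitIdx, map_add]
    simp [hM]

theorem delTrunc_normalOrder_delPowSymbol (B m : Idx d) (i : Fin d) (π : PS d L) :
    S.delTrunc B i (S.normalOrder π (delPowSymbol B m)) =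
      (m i + 1 : ℝ) • S.normalOrder π (delPowSymbol B (m + unitIdx i)) := by
  rw [delTrunc_normalOrder, ← delPowSymbol_add_unitIdx, LinearMap.map_smul_of_tower]

theorem agree_delPow (B m : Idx d) (π : PS d L) :
    Agree B (S.delPow m π)
      ((idxFactorial m : ℝ) • S.normalOrder π (delPowSymbol B m)) := by
  classical
  let T : Fin d → Module.End ℝ (PS d L) := fun i => (S.del i : PS d L →ₗ[ℝ] PS d L)
  -- Starting from exponent `n i = 0`, the successive factors `1, 2, …, r` accumulate to `r!`. The
  -- directions are then treated one by one, each starting from zero.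
  have hpow : ∀ (i : Fin d) (n : Idx d) (c : ℝ) (a : PS d L) (r : ℕ), n i = 0 →
      Agree B a (c • S.normalOrder π (delPowSymbol B n)) →
      Agree B ((T i ^ r) a)
        (((r ! : ℝ) * c) • S.normalOrder π (delPowSymbol B (n + r • unitIdx i))) := by
    intro i n c a r hn ha
    induction r with
    | zero => simpa using ha
    | succ r ih =>
      have h := S.agree_del ih i
      rw [Derivation.map_smul, delTrunc_normalOrder_delPowSymbol, smul_smul, add_assoc,
        ← succ_nsmul] at h
      rw [pow_succ', Module.End.mul_apply]
      convert h using 2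
      · rfl
      · simp only [Pi.add_apply, Pi.smul_apply, hn, unitIdx, Pi.single_eq_same, smul_eq_mul, mul_one,
          zero_add, Nat.factorial_succ]
        push_cast
        ring
  have hlist : ∀ l : List (Fin d), l.Nodup → Agree B ((l.map fun i => T i ^ m i).prod π)
      (((∏ i ∈ l.toFinset, (m i)! : ℕ) : ℝ) •
        S.normalOrder π (delPowSymbol B fun i => if i ∈ l then m i else 0)) := by
    intro l hl
    induction l with
    | nil =>
      have : (fun i : Fin d => if i ∈ [] then m i else 0) = 0 := by ext; simp
      intro β _
      rw [this, delPowSymbol_zero, ← MvPolynomial.C_1, MvPolynomial.C_apply, normalOrder_monomial,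
        Dpow_zero]
      simp
    | cons i l ih =>
      obtain ⟨hi, hl'⟩ := List.nodup_cons.1 hl
      have h := hpow i _ _ _ (m i) (if_neg hi) (ih hl')
      rw [List.map_cons, List.prod_cons, Module.End.mul_apply, List.toFinset_cons,
        Finset.prod_insert (by simpa using hi), Nat.cast_mul]
      convert h using 4
      ext j
      by_cases hj : j = i
      · subst hj
        simp [unitIdx, hi]
      · simp [unitIdx, hj]
  have h := hlist (List.finRange d) (List.nodup_finRange d)
  rw [List.toFinset_finRange] at h
  simp only [List.mem_finRange, if_true] at h
  rw [delPow, List.ofFn_eq_map]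
  exact h

end Setting

theorem monomial_mem_map_C {σ R : Type*} [CommRing R] {I : Ideal R} {a : R} (ha : a ∈ I)
    (m : σ →₀ ℕ) : MvPolynomial.monomial m a ∈ I.map (MvPolynomial.C (σ := σ)) := by
  rw [← mul_one a, ← MvPolynomial.C_mul_monomial]
  exact Ideal.mul_mem_right _ _ (Ideal.mem_map_of_mem _ ha)

theorem coeff_mul_eq_zero_of_mem_belowIdeal {σ : Type*} {β : σ →₀ ℕ} {a : MvPowerSeries σ ℝ}
    (ha : a ∈ belowIdeal β) (b : MvPowerSeries σ ℝ) : MvPowerSeries.coeff β (a * b) = 0 :=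
  (belowIdeal β).mul_mem_right b ha β le_rfl

/-! ### Bounds for the multi-indices that enter one coefficient -/

namespace Setting

variable {d : ℕ} {L : Type*} (S : Setting d L)

theorem e_inr_notMem_N (m : Idx d) : e (.inr m) ∉ S.N := fun h => by
  have := h.2
  rw [noise_e_inr] at this
  exact lt_irrefl _ this

theorem zero_notMem_N : (0 : MI (Coord d L)) ∉ S.N := fun h => by
  have := h.1.1
  simp [bracket] at this

/-- One bound for both kinds of terms in `f^(𝐧)`: those with `|𝐧| < η`, finitely many as `sᵢ ≥ 1`,
and the polynomial ones `e_𝐦` visible in `β`. -/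
theorem exists_bound (β : MI (Coord d L)) :
    ∃ B : Idx d, PolyBounded B β ∧ ∀ n, S.deg n < S.η → n ≤ B := by
  have h1 : {n : Idx d | β (.inr n) ≠ 0}.Finite := by
    refine (β.support.finite_toSet.preimage (Sum.inr_injective.injOn)).subset fun n hn => ?_
    simpa using hn
  obtain ⟨B, hB⟩ := (h1.union S.finite_deg_lt).bddAbove
  exact ⟨B, fun n hn => hB (.inl hn), fun n hn => hB (.inr hn)⟩

theorem finite_jets_below (β : MI (Coord d L)) : {q : S.Mminus | q.1.1.1 ≤ β}.Finite := by
  classical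
  refine (((Finset.Iic β).finite_toSet.prod S.finite_deg_lt).preimage
    (f := fun q : S.Mminus => (q.1.1.1, q.1.2)) ?_).subset fun q hq => ?_
  · rintro ⟨⟨⟨γ, _⟩, n⟩, _⟩ _ ⟨⟨⟨γ', _⟩, n'⟩, _⟩ _ h
    simp only [Prod.mk.injEq] at h
    obtain ⟨rfl, rfl⟩ := h
    rfl
  · exact ⟨by simpa using hq, q.2⟩

theorem PolyBounded.coeff_mul_eq {B : Idx d} {β : MI (Coord d L)} (hβ : PolyBounded B β)
    {x y : PS d L} (h : Agree B x y) (a : PS d L) :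
    MvPowerSeries.coeff β (a * x) = MvPowerSeries.coeff β (a * y) := by
  classical
  rw [MvPowerSeries.coeff_mul, MvPowerSeries.coeff_mul]
  refine Finset.sum_congr rfl fun p hp => ?_
  rw [h p.2 fun n hn => hβ n fun h0 => hn ?_]
  have := Finset.HasAntidiagonal.antidiagonal.snd_le hp (.inr n)
  omega

/-! ### The coefficients of `f^(𝐧)` -/

section Series

variable {S} (f : S.Char)

theorem Char.coeff_series_of_mem {γ : MI (Coord d L)} (h : γ ∈ S.N) {n : Idx d}
    (hn : S.deg n < S.η) : MvPowerSeries.coeff γ (f.series n) =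
      f (MvPolynomial.X (.inl ⟨(⟨γ, h⟩, n), hn⟩)) := by
  change Char.series f n γ = _
  rw [Char.series, dif_pos ⟨h, hn⟩]

theorem Char.coeff_series_e {n m : Idx d} (h : n < m) :
    MvPowerSeries.coeff (e (.inr m)) (f.series n) = idxChoose m n * f.val 0 (m - n) := by
  change Char.series f n _ = _
  have hex : ∃ m' : Idx d, e (Sum.inr m : Coord d L) = e (.inr m') ∧ n < m' := ⟨m, rfl, h⟩
  rw [Char.series, dif_neg (fun h' => S.e_inr_notMem_N m h'.1), dif_pos hex]
  have : hex.choose = m := by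
    have := hex.choose_spec.1
    exact (Sum.inr_injective (Finsupp.single_left_injective one_ne_zero this)).symm
  rw [this]

theorem Char.coeff_series_eq_zero {n : Idx d} {γ : MI (Coord d L)}
    (h1 : ¬(γ ∈ S.N ∧ S.deg n < S.η)) (h2 : ∀ m, γ = e (.inr m) → ¬ n < m) :
    MvPowerSeries.coeff γ (f.series n) = 0 := by
  change Char.series f n γ = _
  rw [Char.series, dif_neg (fun h => h1 ⟨h.1, h.2⟩), dif_neg]
  rintro ⟨m, hm, hlt⟩
  exact h2 m hm hlt

theorem Char.coeff_series_ne_zero {n : Idx d} {γ : MI (Coord d L)}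
    (h : MvPowerSeries.coeff γ (f.series n) ≠ 0) :
    (γ ∈ S.N ∧ S.deg n < S.η) ∨ ∃ m, γ = e (.inr m) ∧ n < m := by
  by_contra hne
  rw [not_or, not_exists] at hne
  exact h (f.coeff_series_eq_zero hne.1 fun m hm hlt => hne.2 m ⟨hm, hlt⟩)

theorem Char.series_mem_populated (n : Idx d) : f.series n ∈ T S.populated := by
  intro γ hγ
  by_contra hne
  rcases f.coeff_series_ne_zero hne with ⟨h, -⟩ | ⟨m, rfl, -⟩
  · exact hγ (.inr h)
  · exact hγ (.inl ⟨m, rfl⟩)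

theorem Char.series_mem_ker (n : Idx d) :
    f.series n ∈ RingHom.ker (MvPowerSeries.constantCoeff (σ := Coord d L) (R := ℝ)) := by
  rw [RingHom.mem_ker, ← MvPowerSeries.coeff_zero_eq_constantCoeff_apply]
  by_contra hne
  rcases f.coeff_series_ne_zero hne with ⟨h, -⟩ | ⟨m, h, -⟩
  · exact S.zero_notMem_N h
  · exact one_ne_zero (Finsupp.single_eq_zero.1 h.symm)

/-- A coefficient in `𝒩` requires `|𝐧| < η`, a coefficient at `e_𝐦 ≤ β` requires `𝐧 < 𝐦 ≤ B`; either
way `𝐧 ≤ B`. -/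
theorem Char.series_mem_belowIdeal {B : Idx d} {β : MI (Coord d L)} (hβ : PolyBounded B β)
    (hB : ∀ n, S.deg n < S.η → n ≤ B) {n : Idx d} (hn : ¬ n ≤ B) :
    f.series n ∈ belowIdeal β := by
  intro γ hγ
  by_contra hne
  rcases f.coeff_series_ne_zero hne with ⟨-, h⟩ | ⟨m, rfl, h⟩
  · exact hn (hB n h)
  · refine hn (h.le.trans (hβ m fun h0 => ?_))
    have := hγ (.inr m)
    simp [h0] at this

end Series

/-! ### The exponential in terms of symbols -/

section Exponential

variable {S} (f : S.Char)

/-- The symbol `∑ₙ f^(𝐧) 𝖷_𝐧`, truncated. -/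
def Char.symbol (B : Idx d) : MvPolynomial (Idx d) (PS d L) :=
  ∑ n ∈ Finset.Iic B, MvPolynomial.monomial (e n) (f.series n)

/-- Read off from the prefactor `f^(𝐧₁) ⋯ f^(𝐧_l)` alone, so the bounds are uniform in `π`. -/
theorem Char.expTerm_ne_zero {B : Idx d} {β : MI (Coord d L)} (hβ : PolyBounded B β)
    (hB : ∀ n, S.deg n < S.η → n ≤ B) {l : ℕ} {ν : Fin l → Idx d} {π : PS d L}
    (h : MvPowerSeries.coeff β (f.expTerm ν π) ≠ 0) : l < β.degree + 1 ∧ ∀ j, ν j ≤ B := by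
  constructor
  · by_contra hl
    refine h (coeff_mul_eq_zero_of_mem_belowIdeal
      (ker_constantCoeff_pow_le β (Nat.lt_succ_self _)
        (Ideal.pow_le_pow_right (not_lt.1 hl) ?_)) _)
    have := Ideal.prod_mem_prod (s := Finset.univ) (x := fun j => f.series (ν j))
      fun j _ => f.series_mem_ker (ν j)
    simpa using this
  · intro j
    by_contra hj
    refine h (coeff_mul_eq_zero_of_mem_belowIdeal ?_ _)
    exact Ideal.mem_of_dvd _ (Finset.dvd_prod_of_mem _ (Finset.mem_univ j))
      (f.series_mem_belowIdeal hβ hB hj)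

theorem Char.finite_expTerm (β : MI (Coord d L)) :
    {ν : (l : ℕ) × (Fin l → Idx d) | ∃ π, MvPowerSeries.coeff β (f.expTerm ν.2 π) ≠ 0}.Finite := by
  classical
  obtain ⟨B, hβ, hB⟩ := S.exists_bound β
  refine ((Finset.range (β.degree + 1)).sigma fun l =>
    Fintype.piFinset fun _ : Fin l => Finset.Iic B).finite_toSet.subset ?_
  rintro ⟨l, ν⟩ ⟨π, h⟩
  obtain ⟨h1, h2⟩ := f.expTerm_ne_zero hβ hB h
  simpa using ⟨Nat.lt_succ_iff.1 h1, h2⟩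

theorem Char.coeff_exponential {B : Idx d} {β : MI (Coord d L)} (hβ : PolyBounded B β)
    (hB : ∀ n, S.deg n < S.η → n ≤ B) (π : PS d L) :
    MvPowerSeries.coeff β (f.exponential π) =
      MvPowerSeries.coeff β (S.normalOrder π (truncExp (β.degree + 1) (f.symbol B))) := by
  classical
  have h1 : ∀ l : ℕ, ∑ᶠ ν : Fin l → Idx d, MvPowerSeries.coeff β (f.expTerm ν π) =
      ∑ ν ∈ Fintype.piFinset fun _ : Fin l => Finset.Iic B,
        MvPowerSeries.coeff β (f.expTerm ν π) := fun l =>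
    finsum_eq_sum_of_support_subset _ fun ν hν =>
      Finset.mem_coe.2 (Fintype.mem_piFinset.2 fun j =>
        Finset.mem_Iic.2 ((f.expTerm_ne_zero hβ hB hν).2 j))
  change ∑ᶠ l : ℕ, (l ! : ℝ)⁻¹ * _ = _
  rw [finsum_eq_sum_of_support_subset (s := Finset.range (β.degree + 1)), truncExp, map_sum,
    map_sum]
  · refine Finset.sum_congr rfl fun l _ => ?_
    have h2 : f.symbol B ^ l = ∑ ν ∈ Fintype.piFinset fun _ : Fin l => Finset.Iic B,
        ∏ j, MvPolynomial.monomial (e (ν j)) (f.series (ν j)) := by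
      have := Finset.prod_univ_sum (fun _ : Fin l => Finset.Iic B)
        (fun _ n => MvPolynomial.monomial (e n) (f.series n))
      rw [← this, Finset.prod_const, Finset.card_univ, Fintype.card_fin]
      rfl
    rw [h1, h2, LinearMap.map_smul_of_tower, map_smul, map_sum, map_sum, smul_eq_mul]
    simp only [expTerm_eq]
  · intro l hl
    obtain ⟨ν, hν⟩ : ∃ ν : Fin l → Idx d, MvPowerSeries.coeff β (f.expTerm ν π) ≠ 0 := by
      by_contra! h
      refine hl ?_
      simp [h]
    simpa using (Nat.lt_succ_iff.1 (f.expTerm_ne_zero hβ hB hν).1)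

end Exponential

end Setting

/-! ### The symbol of `Γ` as a product of two exponentials -/

namespace Setting

variable {d : ℕ} {L : Type*} {S : Setting d L} (f : S.Char)

theorem coeff_polyVar {B m : Idx d} (γ : MI (Coord d L)) (h : MvPowerSeries.coeff γ
    (polyVar B m : PS d L) ≠ 0) : m ≤ B ∧ γ = e (.inr m) := by
  classical
  rw [polyVar] at h
  split_ifs at h with hB
  · refine ⟨hB, ?_⟩
    rw [MvPowerSeries.coeff_X] at h
    by_contra hne
    exact h (if_neg hne)
  · simp at h

theorem jetMon_eq (J : MI S.Mminus) :
    S.jetMon J = zmon (J.sum fun q a => a • q.1.1.1) := by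
  rw [jetMon, Finsupp.prod, Finsupp.sum]
  simp only [zmon, MvPowerSeries.monomial_pow, one_pow]
  rw [MvPowerSeries.prod_monomial]
  simp

/-- The monomial `𝗓^J` must divide `𝗓^β`, and since `0 ∉ 𝒩` every factor uses up at least one degree
of `β`. -/
theorem jetMon_coeff_ne_zero {β : MI (Coord d L)} {J : MI S.Mminus} {a : PS d L}
    (h : MvPowerSeries.coeff β (S.jetMon J * a) ≠ 0) :
    J ∈ multiIndices (S.finite_jets_below β).toFinset (β.degree + 1) := by
  classical
  rw [jetMon_eq, MvPowerSeries.coeff_monomial_mul] at h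
  have hle : (J.sum fun q a => a • q.1.1.1) ≤ β := by
    by_contra hne
    exact h (if_neg hne)
  rw [mem_multiIndices]
  constructor
  · intro q hq
    rw [Set.Finite.mem_toFinset]
    refine le_trans ?_ hle
    refine le_trans ?_ (Finset.single_le_sum (f := fun q => J q • q.1.1.1)
      (fun _ _ => zero_le) hq)
    exact le_self_nsmul (zero_le) (Finsupp.mem_support_iff.1 hq)
  · refine Nat.lt_succ_of_le (le_trans ?_ (Finsupp.degree_mono hle))
    rw [Finsupp.sum, map_sum, length, Finsupp.sum]
    refine Finset.sum_le_sum fun q _ => ?_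
    rw [map_nsmul, smul_eq_mul]
    refine Nat.le_mul_of_pos_right _ (Nat.pos_of_ne_zero fun h0 => ?_)
    have := q.1.1.2
    rw [(Finsupp.degree_eq_zero_iff _).1 h0] at this
    exact S.zero_notMem_N this

/-- The power series without constant coefficient. -/
def augIdeal (d : ℕ) (L : Type*) : Ideal (PS d L) :=
  RingHom.ker (MvPowerSeries.constantCoeff (σ := Coord d L) (R := ℝ))

theorem mem_augIdeal {a : PS d L} : a ∈ augIdeal d L ↔ MvPowerSeries.coeff 0 a = 0 := by
  rw [augIdeal, RingHom.mem_ker, ← MvPowerSeries.coeff_zero_eq_constantCoeff_apply]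

/-- The symbols without constant coefficients. -/
abbrev augSymbolIdeal (d : ℕ) (L : Type*) : Ideal (MvPolynomial (Idx d) (PS d L)) :=
  (augIdeal d L).map MvPolynomial.C

theorem augSymbolIdeal_pow_le (β : MI (Coord d L)) :
    augSymbolIdeal d L ^ (β.degree + 1) ≤ symbolIdeal β := by
  rw [← Ideal.map_pow]
  exact Ideal.map_mono (ker_constantCoeff_pow_le β (Nat.lt_succ_self _))

theorem polyVar_mem_augIdeal (B n : Idx d) : polyVar B n ∈ augIdeal d L := by
  rw [mem_augIdeal]
  by_contra hne
  exact one_ne_zero (Finsupp.single_eq_zero.1 (coeff_polyVar 0 hne).2.symm)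

theorem shiftSymbol_mem (B : Idx d) :
    shiftSymbol B ∈ (augSymbolIdeal d L).map (MvPolynomial.C (σ := Fin d)) := by
  refine Submodule.sum_mem _ fun n _ => Submodule.sum_mem _ fun u _ =>
    monomial_mem_map_C (monomial_mem_map_C ?_ _) _
  exact Submodule.smul_of_tower_mem (augIdeal d L) _ (polyVar_mem_augIdeal B _)

/-- Trades the truncation order `|𝐦| + 1`, exact in `𝗍`, for the order `|β| + 1`, valid modulo the
ideal because the coefficients of `H` have no constant term. All `𝐦` then share one polynomial in
`𝗍`, which also shows that only finitely many `𝐦` matter. -/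
theorem delPowSymbol_sub_mem (B m : Idx d) (β : MI (Coord d L)) :
    delPowSymbol B m - (truncExp (β.degree + 1) (shiftSymbol B)).coeff (toMI m) ∈
      symbolIdeal β := by
  have hpow : ((augSymbolIdeal d L).map (MvPolynomial.C (σ := Fin d))) ^ (β.degree + 1) ≤
      (symbolIdeal β).map (MvPolynomial.C (σ := Fin d)) := by
    rw [← Ideal.map_pow]
    exact Ideal.map_mono (augSymbolIdeal_pow_le β)
  obtain ⟨M, h1, h2⟩ : ∃ M, β.degree + 1 ≤ M ∧ (toMI m).degree < M :=
    ⟨max (β.degree + 1) ((toMI m).degree + 1), le_max_left _ _,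
      lt_of_lt_of_le (Nat.lt_succ_self _) (le_max_right _ _)⟩
  have h := MvPolynomial.mem_map_C_iff.1
    (truncExp_sub_truncExp_mem hpow (shiftSymbol_mem B) h1) (toMI m)
  rwa [MvPolynomial.coeff_sub, delPowSymbol_eq B m h2] at h

theorem Char.coeff_gammaTerm {B : Idx d} {β : MI (Coord d L)} (hβ : PolyBounded B β)
    (J : MI S.Mminus) (m : Idx d) (π : PS d L) :
    MvPowerSeries.coeff β (f.gammaTerm (J, m) π) =
      f.val J m * (miFactorial J : ℝ)⁻¹ * MvPowerSeries.coeff β (S.normalOrder π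
        (MvPolynomial.monomial (S.jetIdx J) (S.jetMon J) *
          (truncExp (β.degree + 1) (shiftSymbol B)).coeff (toMI m))) := by
  have h1 : MvPowerSeries.coeff β (S.normalOrder π (MvPolynomial.monomial (S.jetIdx J) (S.jetMon J) *
      (truncExp (β.degree + 1) (shiftSymbol B)).coeff (toMI m))) =
      MvPowerSeries.coeff β (S.normalOrder π (MvPolynomial.monomial (S.jetIdx J) (S.jetMon J) *
        delPowSymbol B m)) := by
    symm
    refine S.coeff_normalOrder_congr ?_ π
    rw [← mul_sub]
    exact Ideal.mul_mem_left _ _ (delPowSymbol_sub_mem B m β)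
  have h2 : (idxFactorial m : ℝ) ≠ 0 := by
    rw [Nat.cast_ne_zero]
    exact Finset.prod_ne_zero_iff.2 fun i _ => Nat.factorial_ne_zero _
  rw [h1, gammaTerm_apply, map_smul, hβ.coeff_mul_eq (S.agree_delPow B m _), mul_smul_comm,
    map_smul, normalOrder_monomial_mul, smul_eq_mul, smul_eq_mul]
  field_simp

/-- The exponents of the formal variables that matter at or below `β`. -/
def shiftExponents (_ : Setting d L) (B : Idx d) (β : MI (Coord d L)) : Finset (Idx d) :=
  (truncExp (β.degree + 1) (shiftSymbol B :
    MvPolynomial (Fin d) (MvPolynomial (Idx d) (PS d L)))).support.map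
      Finsupp.equivFunOnFinite.toEmbedding

theorem Char.gammaTerm_ne_zero {B : Idx d} {β : MI (Coord d L)} (hβ : PolyBounded B β)
    {q : MI S.Mminus × Idx d} {π : PS d L}
    (h : MvPowerSeries.coeff β (f.gammaTerm q π) ≠ 0) :
    q ∈ multiIndices (S.finite_jets_below β).toFinset (β.degree + 1) ×ˢ
      S.shiftExponents B β := by
  obtain ⟨J, m⟩ := q
  rw [f.coeff_gammaTerm hβ] at h
  rw [Finset.mem_product]
  constructor
  · have h1 := right_ne_zero_of_mul h
    rw [normalOrder_monomial_mul] at h1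
    exact jetMon_coeff_ne_zero h1
  · by_contra hm
    refine h ?_
    have : (truncExp (β.degree + 1) (shiftSymbol B :
        MvPolynomial (Fin d) (MvPolynomial (Idx d) (PS d L)))).coeff (toMI m) = 0 := by
      by_contra hne
      refine hm (Finset.mem_map.2 ⟨toMI m, MvPolynomial.mem_support_iff.2 hne, ?_⟩)
      rfl
    rw [this, mul_zero, map_zero, map_zero, mul_zero]

theorem Char.finite_gammaTerm (β : MI (Coord d L)) :
    {q | ∃ π, MvPowerSeries.coeff β (f.gammaTerm q π) ≠ 0}.Finite := by
  obtain ⟨B, hβ, -⟩ := S.exists_bound β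
  exact (Finset.finite_toSet (multiIndices (S.finite_jets_below β).toFinset (β.degree + 1) ×ˢ
    S.shiftExponents B β)).subset fun q ⟨π, h⟩ => f.gammaTerm_ne_zero hβ h

/-- The symbol `∑ 𝐟_γ^(𝐧) 𝗓^γ 𝖷_𝐧` over the pairs with `γ ≤ β`. -/
def Char.jetSymbol (β : MI (Coord d L)) : MvPolynomial (Idx d) (PS d L) :=
  ∑ q ∈ (S.finite_jets_below β).toFinset, MvPolynomial.monomial (e q.1.2)
    (f (MvPolynomial.X (.inl q)) • zmon q.1.1.1)

theorem Char.truncExp_jetSymbol (β : MI (Coord d L)) (l : ℕ) :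
    truncExp l (f.jetSymbol β) =
      ∑ J ∈ multiIndices (S.finite_jets_below β).toFinset l,
        ((miFactorial J : ℝ)⁻¹ * J.prod fun q a => f (MvPolynomial.X (.inl q)) ^ a) •
          MvPolynomial.monomial (S.jetIdx J) (S.jetMon J) := by
  rw [jetSymbol, truncExp_sum]
  refine Finset.sum_congr rfl fun J _ => ?_
  rw [mul_smul]
  congr 1
  have : ∀ (q : S.Mminus) (a : ℕ), MvPolynomial.monomial (e q.1.2)
      (f (MvPolynomial.X (.inl q)) • zmon q.1.1.1 : PS d L) ^ a =
      MvPolynomial.monomial (a • e q.1.2)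
        (f (MvPolynomial.X (.inl q)) ^ a • (zmon q.1.1.1 : PS d L) ^ a) := by
    intro q a
    rw [MvPolynomial.monomial_pow, smul_pow]
  simp only [this, Finsupp.prod]
  rw [← MvPolynomial.monomial_sum_prod, Finset.prod_smul, MvPolynomial.smul_monomial]
  rfl

/-- The evaluation of the formal variables at the values of the character. -/
def Char.evalShift :
    MvPolynomial (Fin d) (MvPolynomial (Idx d) (PS d L)) →ₐ[ℝ] MvPolynomial (Idx d) (PS d L) :=
  (MvPolynomial.aeval fun i => algebraMap ℝ (MvPolynomial (Idx d) (PS d L))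
    (f (MvPolynomial.X (.inr i)))).restrictScalars ℝ

theorem Char.evalShift_monomial (m : MI (Fin d)) (c : MvPolynomial (Idx d) (PS d L)) :
    f.evalShift (MvPolynomial.monomial m c) = f.val 0 m • c := by
  rw [evalShift, AlgHom.restrictScalars_apply, MvPolynomial.aeval_monomial, Char.val_eq,
    Finsupp.prod_fintype _ _ (by simp), Finsupp.prod_zero_index, one_mul]
  simp only [← map_pow, ← map_prod]
  rw [mul_comm, ← Algebra.smul_def]
  rfl

theorem Char.val_eq_mul (J : MI S.Mminus) (m : Idx d) :
    f.val J m = (J.prod fun q a => f (MvPolynomial.X (.inl q)) ^ a) * f.val 0 m := by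
  rw [val_eq, val_eq, Finsupp.prod_zero_index, one_mul]

/-- Weighting the coefficients of `𝗍^𝐦` by `𝐟^(0,𝐦)` is evaluation at the values of the `𝖹ᵢ`, an
algebra morphism, which therefore passes through the exponential. -/
theorem Char.evalShift_truncExp (B : Idx d) (β : MI (Coord d L)) :
    truncExp (β.degree + 1) (f.evalShift (shiftSymbol B)) =
      ∑ m ∈ S.shiftExponents B β,
        f.val 0 m • (truncExp (β.degree + 1) (shiftSymbol B)).coeff (toMI m) := by
  have h : truncExp (β.degree + 1) (f.evalShift (shiftSymbol B)) =
      f.evalShift (truncExp (β.degree + 1) (shiftSymbol B)) := by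
    simp only [truncExp, map_sum, map_smul, map_pow]
  rw [h]
  conv_lhs => rw [← MvPolynomial.support_sum_monomial_coeff (truncExp (β.degree + 1) (shiftSymbol B))]
  rw [map_sum, shiftExponents, Finset.sum_map]
  refine Finset.sum_congr rfl fun m _ => ?_
  rw [evalShift_monomial]
  congr 2
  ext
  rfl

/-- The double sum factorises since the value of the character on `𝖹^(J,𝐦)` is the product of its
values on the two parts. -/
theorem Char.coeff_gamma_eq {B : Idx d} {β : MI (Coord d L)} (hβ : PolyBounded B β)
    (π : PS d L) : MvPowerSeries.coeff β (f.gamma π) =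
      MvPowerSeries.coeff β (S.normalOrder π (truncExp (β.degree + 1) (f.jetSymbol β) *
        truncExp (β.degree + 1) (f.evalShift (shiftSymbol B)))) := by
  change ∑ᶠ q, MvPowerSeries.coeff β (f.gammaTerm q π) = _
  rw [finsum_eq_sum_of_support_subset _ (fun q hq => Finset.mem_coe.2 (f.gammaTerm_ne_zero hβ hq)),
    Finset.sum_product, truncExp_jetSymbol, evalShift_truncExp, Finset.sum_mul_sum, map_sum,
    map_sum]
  refine Finset.sum_congr rfl fun J _ => ?_
  rw [map_sum, map_sum]
  refine Finset.sum_congr rfl fun m _ => ?_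
  rw [f.coeff_gammaTerm hβ, smul_mul_smul_comm, LinearMap.map_smul_of_tower, map_smul, smul_eq_mul,
    f.val_eq_mul J m]
  ring

/-- The two exponents are the two nontrivial cases in the definition of `f^(𝐧)`: the jets give the
coefficients in `𝒩`, and `H` gives those at `e_𝐦`, with `𝐦 = 𝐧 + 𝐮`. The agreement is only at and
below `β`, as jets with `γ ≰ β` and variables beyond `B` are left out. -/
theorem Char.symbol_sub_mem {B : Idx d} {β : MI (Coord d L)} (hβ : PolyBounded B β)
    (hB : ∀ n, S.deg n < S.η → n ≤ B) :
    f.jetSymbol β + f.evalShift (shiftSymbol B) - f.symbol B ∈ symbolIdeal β := by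
  classical
  set t := (S.finite_jets_below β).toFinset with ht
  have h1 : f.jetSymbol β = ∑ n ∈ Finset.Iic B, MvPolynomial.monomial (e n)
      (∑ q ∈ t with q.1.2 = n, f (MvPolynomial.X (.inl q)) • (zmon q.1.1.1 : PS d L)) := by
    rw [jetSymbol, ← Finset.sum_fiberwise_of_maps_to (t := Finset.Iic B) (g := fun q => q.1.2)
      fun q _ => Finset.mem_Iic.2 (hB _ q.2)]
    refine Finset.sum_congr rfl fun n _ => ?_
    rw [map_sum]
    refine Finset.sum_congr rfl fun q hq => ?_
    rw [(Finset.mem_filter.1 hq).2]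
  have h2 : f.evalShift (shiftSymbol B) = ∑ n ∈ Finset.Iic B, MvPolynomial.monomial (e n)
      (∑ u ∈ (Finset.Iic B).erase 0,
        (f.val 0 u * idxChoose (n + u) n) • (polyVar B (n + u) : PS d L)) := by
    rw [shiftSymbol, map_sum]
    refine Finset.sum_congr rfl fun n _ => ?_
    rw [map_sum, map_sum]
    refine Finset.sum_congr rfl fun u _ => ?_
    rw [evalShift_monomial, mul_smul, MvPolynomial.smul_monomial]
    rfl
  rw [h1, h2, symbol, ← Finset.sum_add_distrib, ← Finset.sum_sub_distrib]
  refine Submodule.sum_mem _ fun n hn => ?_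
  rw [← map_add, ← map_sub]
  refine monomial_mem_map_C (fun γ hγ => ?_) _
  rw [map_sub, map_add, sub_eq_zero, map_sum, map_sum]
  have hjet : ∀ q : S.Mminus, q.1.2 = n → MvPowerSeries.coeff γ
      (f (MvPolynomial.X (.inl q)) • (zmon q.1.1.1 : PS d L)) ≠ 0 → q.1.1.1 = γ := by
    intro q _ hne
    rw [map_smul, MvPowerSeries.coeff_monomial] at hne
    by_contra h
    exact hne (by rw [if_neg (Ne.symm h), smul_zero])
  by_cases h : γ ∈ S.N ∧ S.deg n < S.η
  · rw [f.coeff_series_of_mem h.1 h.2, Finset.sum_eq_single ⟨(⟨γ, h.1⟩, n), h.2⟩,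
      Finset.sum_eq_zero, add_zero]
    · rw [map_smul, MvPowerSeries.coeff_monomial_same, smul_eq_mul, mul_one]
    · intro u _
      by_contra hne
      rw [map_smul] at hne
      refine S.e_inr_notMem_N (n + u) ?_
      rw [← (coeff_polyVar γ (right_ne_zero_of_smul hne)).2]
      exact h.1
    · intro q hq hne
      by_contra h0
      have hqn := (Finset.mem_filter.1 hq).2
      have := hjet q hqn h0
      refine hne (Subtype.ext (Prod.ext (Subtype.ext this) hqn))
    · intro hnot
      exfalso
      refine hnot (Finset.mem_filter.2 ⟨?_, rfl⟩)
      rw [ht, Set.Finite.mem_toFinset]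
      exact hγ
  · rw [Finset.sum_eq_zero (s := t.filter _), zero_add]
    · by_cases hm : ∃ m, γ = e (.inr m) ∧ n < m
      · obtain ⟨m, rfl, hlt⟩ := hm
        have hmB : m ≤ B := hβ m fun h0 => by
          have := hγ (.inr m)
          simp [h0] at this
        have hnm : n + (m - n) = m := add_tsub_cancel_of_le hlt.le
        rw [f.coeff_series_e hlt, Finset.sum_eq_single (m - n)]
        · rw [hnm, map_smul, polyVar, if_pos hmB, MvPowerSeries.X_def,
            MvPowerSeries.coeff_monomial_same, smul_eq_mul, mul_one, mul_comm]
        · intro u _ hne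
          by_contra h0
          rw [map_smul] at h0
          have h3 := (coeff_polyVar _ (right_ne_zero_of_smul h0)).2
          have h4 : m = n + u := Sum.inr_injective (Finsupp.single_left_injective one_ne_zero h3)
          exact hne (by rw [h4, add_tsub_cancel_left])
        · intro hnot
          refine absurd (Finset.mem_erase.2 ⟨?_, Finset.mem_Iic.2 (tsub_le_self.trans hmB)⟩) hnot
          intro h0
          rw [h0, add_zero] at hnm
          exact hlt.ne hnm
      · rw [f.coeff_series_eq_zero h fun m h3 h4 => hm ⟨m, h3, h4⟩]
        refine Finset.sum_eq_zero fun u hu => ?_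
        by_contra h0
        rw [map_smul] at h0
        have h3 := (coeff_polyVar _ (right_ne_zero_of_smul h0)).2
        refine hm ⟨n + u, h3, lt_of_le_of_ne (le_add_of_nonneg_right zero_le) fun h4 => ?_⟩
        exact (Finset.mem_erase.1 hu).1 (left_eq_add.1 h4)
    · intro q hq
      by_contra h0
      have hqn := (Finset.mem_filter.1 hq).2
      refine h ⟨?_, hqn ▸ q.2⟩
      rw [← hjet q hqn h0]
      exact q.1.1.2

theorem Char.coeff_gamma {B : Idx d} {β : MI (Coord d L)} (hβ : PolyBounded B β)
    (hB : ∀ n, S.deg n < S.η → n ≤ B) (π : PS d L) :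
    MvPowerSeries.coeff β (f.gamma π) =
      MvPowerSeries.coeff β (S.normalOrder π (truncExp (β.degree + 1) (f.symbol B))) := by
  have hjet : f.jetSymbol β ∈ augSymbolIdeal d L := by
    refine Submodule.sum_mem _ fun q _ => monomial_mem_map_C
      (Submodule.smul_of_tower_mem (augIdeal d L) _ (mem_augIdeal.2 ?_)) _
    refine MvPowerSeries.coeff_monomial_ne (fun h => S.zero_notMem_N ?_) _
    rw [h]
    exact q.1.1.2
  have hshift : f.evalShift (shiftSymbol B) ∈ augSymbolIdeal d L := by
    rw [shiftSymbol, map_sum]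
    refine Submodule.sum_mem _ fun n _ => ?_
    rw [map_sum]
    refine Submodule.sum_mem _ fun u _ => ?_
    rw [evalShift_monomial]
    exact Submodule.smul_of_tower_mem (augSymbolIdeal d L) _ (monomial_mem_map_C
      (Submodule.smul_of_tower_mem (augIdeal d L) _ (polyVar_mem_augIdeal B _)) _)
  rw [f.coeff_gamma_eq hβ, S.coeff_normalOrder_congr
    (truncExp_mul_sub_truncExp_add_mem (augSymbolIdeal_pow_le β) hjet hshift) π, S.coeff_normalOrder_congr
    (truncExp_sub_mem (f.symbol_sub_mem hβ hB) _) π]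

theorem Char.gamma_eq_exponential (π : PS d L) : f.gamma π = f.exponential π := by
  ext β
  obtain ⟨B, hβ, hB⟩ := S.exists_bound β
  rw [f.coeff_gamma hβ hB, f.coeff_exponential hβ hB]

end Setting

namespace Setting

/-! ### Preservation of the power series supported on `𝒩⁻` -/

section Stability

variable {d : ℕ} {L : Type*} (S : Setting d L)

/-- The variant of `𝒩⁻` with `[β] = c`. -/
def bracketSet (c : ℤ) : Set (MI (Coord d L)) :=
  {β | bracket β = c ∧ S.Subcrit β ∧ ∀ n, S.deg n < S.regsol → β (.inr n) = 0}

theorem mul_mem_bracketSet {a b : ℤ} {x y : PS d L} (hx : x ∈ T (S.bracketSet a))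
    (hy : y ∈ T (S.bracketSet b)) : x * y ∈ T (S.bracketSet (a + b)) := by
  classical
  intro β hβ
  rw [MvPowerSeries.coeff_mul]
  refine Finset.sum_eq_zero fun p hp => ?_
  by_contra hne
  have h1 : p.1 ∈ S.bracketSet a := by
    by_contra h
    exact left_ne_zero_of_mul hne (hx _ h)
  have h2 : p.2 ∈ S.bracketSet b := by
    by_contra h
    exact right_ne_zero_of_mul hne (hy _ h)
  refine hβ ?_
  rw [← Finset.HasAntidiagonal.mem_antidiagonal.1 hp]
  refine ⟨by rw [bracket_add, h1.1, h2.1], fun q hq => ?_, fun n hn => ?_⟩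
  · by_cases h0 : p.1 (.inl q) = 0
    · exact h2.2.1 q (by simpa [h0] using hq)
    · exact h1.2.1 q h0
  · rw [Finsupp.add_apply, h1.2.2 n hn, h2.2.2 n hn]

theorem one_mem_bracketSet : (1 : PS d L) ∈ T (S.bracketSet 0) := by
  classical
  intro β hβ
  rw [MvPowerSeries.coeff_one, if_neg]
  rintro rfl
  exact hβ ⟨by simp [bracket], fun p hp => absurd rfl hp, fun n _ => rfl⟩

theorem prod_mem_bracketSet {l : ℕ} {x : Fin l → PS d L}
    (hx : ∀ j, x j ∈ T (S.bracketSet 1)) : ∏ j, x j ∈ T (S.bracketSet l) := by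
  induction l with
  | zero => simpa using S.one_mem_bracketSet
  | succ l ih =>
    rw [Fin.prod_univ_castSucc]
    push_cast
    exact S.mul_mem_bracketSet (ih fun j => hx _) (hx _)

/-- Passing from `(𝔩,k)` to `(𝔩,k+e_𝐧)` costs one in `1 - length k`, and `∂_{𝗓_𝐧}` removes a
coordinate of weight one. New pairs are subcritical by the restriction built into `D^(𝐧)`. -/
theorem D_mem_bracketSet {c : ℤ} {a : PS d L} (ha : a ∈ T (S.bracketSet c)) (n : Idx d) :
    S.D n a ∈ T (S.bracketSet (c - 1)) := by
  classical
  intro β hβ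
  refine S.coeff_D_eq_zero n a β (ha _ fun h => hβ ?_) fun p hp h0 => ha _ fun h => hβ ?_
  · obtain ⟨h1, h2, h3⟩ := h
    rw [bracket_add, bracket_e_inr] at h1
    refine ⟨by linarith, fun q hq => h2 q (by simpa using hq), fun m hm => ?_⟩
    have := h3 m hm
    rw [Finsupp.add_apply] at this
    omega
  · obtain ⟨β', rfl⟩ : ∃ β', β = β' + e (.inl (p.1, p.2 + e n)) :=
      ⟨β - e _, (tsub_add_cancel_of_le (by simpa [Nat.one_le_iff_ne_zero] using h0)).symm⟩
    rw [add_tsub_cancel_right] at h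
    obtain ⟨h1, h2, h3⟩ := h
    rw [bracket_add, bracket_e_inl] at h1
    refine ⟨?_, fun q hq => ?_, fun m hm => by simpa using h3 m hm⟩
    · rw [bracket_add, bracket_e_inl, length_add_e]
      push_cast
      linarith
    · by_cases hqp : q = (p.1, p.2 + e n)
      · rw [hqp]
        exact hp
      · refine h2 q ?_
        have : β' (.inl q) ≠ 0 := by
          simpa [Finsupp.single_apply, Ne.symm hqp] using hq
        simp [this]

theorem prod_DEnd_mem_bracketSet (l : List (Idx d)) {c : ℤ} {a : PS d L}
    (ha : a ∈ T (S.bracketSet c)) :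
    (l.map S.DEnd).prod a ∈ T (S.bracketSet (c - l.length)) := by
  induction l with
  | nil => simpa using ha
  | cons n l ih =>
    rw [List.map_cons, List.prod_cons, List.length_cons, Module.End.mul_apply]
    push_cast
    rw [← sub_sub]
    exact S.D_mem_bracketSet ih n

/-- Since `n < m` forces `m ≠ 0`, the degree of `m` is at least some `sᵢ`. This keeps the polynomial
components of `f^(𝐧)` out of the forbidden range. -/
theorem regsol_le_deg (h : ∀ i, S.regsol ≤ S.s i) {n m : Idx d} (hnm : n < m) :
    S.regsol ≤ S.deg m := by
  obtain ⟨i, hi⟩ := (Pi.lt_def.1 hnm).2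
  have h1 : (1 : ℝ) ≤ m i := by exact_mod_cast (Nat.one_le_of_lt hi)
  have h0 : 0 ≤ S.s i := zero_le_one.trans (S.one_le_s i)
  calc S.regsol ≤ S.s i := h i
    _ ≤ S.s i * m i := le_mul_of_one_le_right h0 h1
    _ ≤ S.deg m := Finset.single_le_sum (f := fun i => S.s i * (m i : ℝ))
        (fun j _ => mul_nonneg (zero_le_one.trans (S.one_le_s j)) (by positivity))
        (Finset.mem_univ i)

variable {S}

theorem Char.series_mem_bracketSet (f : S.Char) (h : ∀ i, S.regsol ≤ S.s i) (n : Idx d) :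
    f.series n ∈ T (S.bracketSet 1) := by
  classical
  intro γ hγ
  by_contra hne
  rcases f.coeff_series_ne_zero hne with ⟨h1, -⟩ | ⟨m, rfl, hlt⟩
  · exact hγ h1.1
  · refine hγ ⟨bracket_e_inr m, fun p hp => absurd (by simp) hp, fun u hu => ?_⟩
    refine Finsupp.single_eq_of_ne fun heq => ?_
    have := Sum.inr_injective heq
    rw [this] at hu
    exact absurd (S.regsol_le_deg h hlt) (not_le.2 hu)

/-- The `l` derivations lower the bracket by `l`, and the `l` factors of bracket one restore it. -/
theorem Char.expTerm_mem (f : S.Char) (h : ∀ i, S.regsol ≤ S.s i) {l : ℕ} (ν : Fin l → Idx d)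
    {π : PS d L} (hπ : π ∈ T S.Nminus) : f.expTerm ν π ∈ T S.Nminus := by
  have h1 : (List.ofFn fun j => ((S.D (ν j) : PS d L →ₗ[ℝ] PS d L) :
      Module.End ℝ (PS d L))).reverse = (List.ofFn ν).reverse.map S.DEnd := by
    rw [List.map_reverse, List.map_ofFn]
    rfl
  have h2 := S.mul_mem_bracketSet (S.prod_mem_bracketSet fun j => f.series_mem_bracketSet h (ν j))
    (S.prod_DEnd_mem_bracketSet (List.ofFn ν).reverse (c := 1) hπ)
  rw [List.length_reverse, List.length_ofFn, add_sub_cancel] at h2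
  rw [expTerm, h1]
  exact h2

theorem Char.gamma_mem (f : S.Char) (h : ∀ i, S.regsol ≤ S.s i) {π : PS d L}
    (hπ : π ∈ T S.Nminus) : f.gamma π ∈ T S.Nminus := by
  intro β hβ
  rw [gamma_eq_exponential]
  change ∑ᶠ l : ℕ, (l ! : ℝ)⁻¹ * ∑ᶠ ν : Fin l → Idx d, MvPowerSeries.coeff β (f.expTerm ν π) = 0
  have : ∀ (l : ℕ) (ν : Fin l → Idx d), MvPowerSeries.coeff β (f.expTerm ν π) = 0 :=
    fun l ν => f.expTerm_mem h ν hπ β hβ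
  simp [this]

end Stability

end Setting

/-! ### The hierarchy as a power series, and Taylor coefficients of polynomials -/

section Hierarchy

variable {d : ℕ} {L : Type*}

theorem coeff_prod_eq_finsum {σ ι : Type*} [Fintype ι] (f : ι → MvPowerSeries σ ℝ)
    (β : σ →₀ ℕ) : MvPowerSeries.coeff β (∏ t, f t) =
      ∑ᶠ (b : ι → σ →₀ ℕ) (_ : ∑ t, b t = β), ∏ t, MvPowerSeries.coeff (b t) (f t) := by
  classical
  have hset : {b : ι → σ →₀ ℕ | ∑ t, b t = β} =
      ((Finset.univ.finsuppAntidiag β).image (fun b : ι →₀ σ →₀ ℕ => ⇑b) : Finset (ι → σ →₀ ℕ)) := by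
    ext b
    simp only [Set.mem_ofPred_eq, Finset.coe_image, Set.mem_image, Finset.mem_coe,
      Finset.mem_finsuppAntidiag, Finset.subset_univ, and_true]
    constructor
    · exact fun hb => ⟨Finsupp.equivFunOnFinite.symm b, hb, rfl⟩
    · rintro ⟨b', hb', rfl⟩
      exact hb'
  have h1 := finsum_mem_coe_finset (fun b => ∏ t, MvPowerSeries.coeff (b t) (f t))
    ((Finset.univ.finsuppAntidiag β).image (fun b : ι →₀ σ →₀ ℕ => ⇑b) : Finset (ι → σ →₀ ℕ))
  rw [← hset, Finset.sum_image DFunLike.coe_injective.injOn] at h1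
  rw [MvPowerSeries.coeff_prod]
  exact h1.symm

/-- The sum over decompositions of `β` is the expansion of a product of power series, so `R_β[h]` is
a coefficient of `∑ ξ_𝔩 𝗓_(𝔩,k) ∏ (h^(𝐧))^{k(𝐧)}`. -/
theorem hierarchyRHS_eq (h : Idx d → PS d L) (ξ : Option L → ℝ) (β : MI (Coord d L)) :
    hierarchyRHS (fun n γ => MvPowerSeries.coeff γ (h n)) ξ β =
      ∑ᶠ p : Option L × MI (Idx d),
        MvPowerSeries.coeff β (MvPowerSeries.X (.inl p) * p.2.prod fun n a => h n ^ a) * ξ p.1 := by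
  classical
  refine finsum_congr fun p => ?_
  have hprod : (p.2.prod fun n a => h n ^ a) =
      ∏ t : (n : p.2.support) × Fin (p.2 n), h t.1 := by
    rw [Fintype.prod_sigma]
    simp only [Finset.prod_const, Finset.card_univ, Fintype.card_fin]
    exact (Finset.prod_coe_sort p.2.support fun n => h n ^ p.2 n).symm
  by_cases hp : e (.inl p) ≤ β
  · obtain ⟨β', rfl⟩ := exists_add_of_le hp
    rw [MvPowerSeries.X_def, MvPowerSeries.coeff_add_monomial_mul, one_mul, hprod,
      coeff_prod_eq_finsum, finsum_mul]
    refine finsum_congr fun b => ?_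
    simp only [add_right_inj]
    by_cases hb : ∑ t, b t = β' <;> simp [hb]
  · rw [coeff_X_mul_eq_zero, zero_mul]
    · refine finsum_eq_zero_of_forall_eq_zero fun b => ?_
      have : ¬ e (.inl p) + ∑ t, b t = β := fun hb => hp (hb ▸ le_self_add)
      simp [this]
    · by_contra h0
      refine hp ?_
      simpa [Nat.one_le_iff_ne_zero] using h0

theorem Finsupp.prod_pow_sub_mem {ι A : Type*} [CommRing A] {I : Ideal A} (k : ι →₀ ℕ)
    {x y : ι → A} (h : ∀ n ∈ k.support, x n - y n ∈ I) :
    (k.prod fun n a => x n ^ a) - (k.prod fun n a => y n ^ a) ∈ I := by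
  rw [← Ideal.Quotient.eq, Finsupp.prod, Finsupp.prod, map_prod, map_prod]
  refine Finset.prod_congr rfl fun n hn => ?_
  rw [map_pow, map_pow, Ideal.Quotient.eq.2 (h n hn)]

theorem partialD_monomial (x : Fin d → ℝ) (a : Idx d) (c : ℝ) (i : Fin d) :
    partialD i (fun y => c * ∏ j, (y j - x j) ^ a j) =
      fun y => (c * a i) * ∏ j, (y j - x j) ^ (a - unitIdx i) j := by
  classical
  funext y
  have hdiff : DifferentiableAt ℝ (fun y : Fin d → ℝ => c * ∏ j, (y j - x j) ^ a j) y := by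
    fun_prop
  -- Along the `i`-th direction only one factor varies, which leaves the derivative of a power in
  -- one variable.
  rw [partialD, ← hdiff.lineDeriv_eq_fderiv, lineDeriv]
  have h1 : (fun t : ℝ => c * ∏ j, ((y + t • (Pi.single i 1 : Fin d → ℝ)) j - x j) ^ a j) =
      fun t => (c * ∏ j ∈ Finset.univ.erase i, (y j - x j) ^ a j) * (t + (y i - x i)) ^ a i := by
    funext t
    rw [← Finset.mul_prod_erase _ _ (Finset.mem_univ i), mul_assoc, mul_comm (∏ j ∈ _, _)]
    congr 2
    · simp
      ring
    · refine Finset.prod_congr rfl fun j hj => ?_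
      simp [Pi.single_eq_of_ne (Finset.ne_of_mem_erase hj)]
  have h2 : HasDerivAt (fun t : ℝ => (c * ∏ j ∈ Finset.univ.erase i, (y j - x j) ^ a j) *
      (t + (y i - x i)) ^ a i) ((c * ∏ j ∈ Finset.univ.erase i, (y j - x j) ^ a j) *
      ((a i : ℝ) * (0 + (y i - x i)) ^ (a i - 1) * 1)) 0 :=
    (((hasDerivAt_id (0 : ℝ)).add_const (y i - x i)).pow (a i)).const_mul _
  rw [h1, h2.deriv, ← Finset.mul_prod_erase _ _ (Finset.mem_univ i)]
  have h3 : ∏ j ∈ Finset.univ.erase i, (y j - x j) ^ (a - unitIdx i) j =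
      ∏ j ∈ Finset.univ.erase i, (y j - x j) ^ a j :=
    Finset.prod_congr rfl fun j hj => by
      simp [unitIdx, Pi.single_eq_of_ne (Finset.ne_of_mem_erase hj)]
  rw [h3]
  simp only [Pi.sub_apply, unitIdx, Pi.single_eq_same]
  ring

theorem partialD_iterate_monomial (x : Fin d → ℝ) (a : Idx d) (c : ℝ) (i : Fin d) (r : ℕ) :
    (partialD i)^[r] (fun y => c * ∏ j, (y j - x j) ^ a j) =
      fun y => (c * (a i).descFactorial r) * ∏ j, (y j - x j) ^ (a - r • unitIdx i) j := by
  induction r with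
  | zero => simp
  | succ r ih =>
    rw [Function.iterate_succ_apply', ih, partialD_monomial, tsub_tsub, ← succ_nsmul,
      Nat.descFactorial_succ]
    funext y
    congr 1
    simp [unitIdx]
    ring

/-- Valid without `n ≤ m`: the binomial vanishes whenever the subtraction in the exponent is
truncated. -/
theorem taylorCoeff_monomial (x : Fin d → ℝ) (n m : Idx d) (y : Fin d → ℝ) :
    taylorCoeff n (fun y => ∏ j, (y j - x j) ^ m j) y =
      idxChoose m n * ∏ j, (y j - x j) ^ (m - n) j := by
  classical
  have key : ∀ l : List (Fin d), l.Nodup →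
      l.foldr (fun i h => (partialD i)^[n i] h) (fun y => ∏ j, (y j - x j) ^ m j) =
        fun y => ((∏ i ∈ l.toFinset, (m i).descFactorial (n i) : ℕ) : ℝ) *
          ∏ j, (y j - x j) ^ (m - fun i => if i ∈ l then n i else 0) j := by
    intro l hl
    induction l with
    | nil => simp
    | cons i l ih =>
      obtain ⟨hi, hl'⟩ := List.nodup_cons.1 hl
      rw [List.foldr_cons, ih hl', partialD_iterate_monomial, List.toFinset_cons,
        Finset.prod_insert (by simpa using hi), tsub_tsub]
      funext y
      congr 1
      · simp [hi, mul_comm]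
      · refine Finset.prod_congr rfl fun j _ => ?_
        congr 1
        by_cases hj : j = i
        · subst hj
          simp [unitIdx, hi]
        · simp [unitIdx, hj]
  have h1 : (idxFactorial n : ℝ) ≠ 0 := by
    rw [Nat.cast_ne_zero]
    exact Finset.prod_ne_zero_iff.2 fun i _ => Nat.factorial_ne_zero _
  have h2 : ∏ i, (m i).descFactorial (n i) = idxFactorial n * idxChoose m n := by
    rw [idxFactorial, idxChoose, ← Finset.prod_mul_distrib]
    exact Finset.prod_congr rfl fun i _ => Nat.descFactorial_eq_factorial_mul_choose _ _
  rw [taylorCoeff, key _ (List.nodup_finRange d), List.toFinset_finRange, h2]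
  simp only [List.mem_finRange, if_true]
  push_cast
  rw [← mul_assoc, ← mul_assoc, inv_mul_cancel₀ h1, one_mul]

theorem taylorCoeff_zero (n : Idx d) (y : Fin d → ℝ) : taylorCoeff n 0 y = 0 := by
  have h1 : ∀ i : Fin d, partialD i (0 : (Fin d → ℝ) → ℝ) = 0 := by
    intro i
    funext y
    simp [partialD]
  have h2 : ∀ (i : Fin d) (r : ℕ), (partialD i)^[r] (0 : (Fin d → ℝ) → ℝ) = 0 :=
    fun i r => Function.iterate_fixed (h1 i) r
  have h3 : ∀ l : List (Fin d), l.foldr (fun i h => (partialD i)^[n i] h) (0 : (Fin d → ℝ) → ℝ) = 0 := by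
    intro l
    induction l with
    | nil => rfl
    | cons i l ih => rw [List.foldr_cons, ih, h2]
  rw [taylorCoeff, h3]
  simp

end Hierarchy

/-! ### The model equations -/

namespace Setting

variable {d : ℕ} {L : Type*} {S : Setting d L}

theorem SubcritPair.deg_lt {p : Option L × MI (Idx d)} (h : S.SubcritPair p) {n : Idx d}
    (hn : n ∈ p.2.support) : S.deg n < S.η := by
  classical
  refine S.deg_lt_of_subcrit (l := p.1) (k := 0) (SubcritPair.mono (k := p.2) h ?_)
  rw [zero_add]
  simpa [Nat.one_le_iff_ne_zero] using Finsupp.mem_support_iff.1 hn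

/-- Only pairs `(𝔩,k)` present in `β` contribute; these are subcritical, so `k` only involves `|𝐧| <
η`. -/
theorem hierarchyRHS_congr {β : MI (Coord d L)} (hβ : S.Subcrit β) {h h' : Idx d → PS d L}
    (hh : ∀ n, S.deg n < S.η → h n - h' n ∈ belowIdeal β) (ξ : Option L → ℝ) :
    hierarchyRHS (fun n γ => MvPowerSeries.coeff γ (h n)) ξ β =
      hierarchyRHS (fun n γ => MvPowerSeries.coeff γ (h' n)) ξ β := by
  rw [hierarchyRHS_eq, hierarchyRHS_eq]
  refine finsum_congr fun p => ?_
  congr 1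
  by_cases hp : β (.inl p) = 0
  · rw [coeff_X_mul_eq_zero hp, coeff_X_mul_eq_zero hp]
  · rw [← sub_eq_zero, ← map_sub, ← mul_sub, mul_comm]
    exact coeff_mul_eq_zero_of_mem_belowIdeal
      (Finsupp.prod_pow_sub_mem p.2 fun n hn => hh n ((hβ p hp).deg_lt hn)) _

theorem Char.prod_series_mem (f : S.Char) (k : MI (Idx d)) :
    (k.prod fun n a => f.series n ^ a) ∈
      RingHom.ker (MvPowerSeries.constantCoeff (σ := Coord d L) (R := ℝ)) ^ length k := by
  rw [length, Finsupp.sum, ← Finset.prod_pow_eq_pow_sum]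
  exact Ideal.prod_mem_prod fun n _ => Ideal.pow_mem_pow (f.series_mem_ker n) _

theorem Char.truncExp_symbol (f : S.Char) (B : Idx d) (l : ℕ) :
    truncExp l (f.symbol B) = ∑ k ∈ multiIndices (Finset.Iic B) l, (miFactorial k : ℝ)⁻¹ •
      MvPolynomial.monomial k (k.prod fun n a => f.series n ^ a) := by
  rw [symbol, truncExp_sum]
  refine Finset.sum_congr rfl fun k _ => ?_
  congr 1
  simp only [MvPolynomial.monomial_pow, Finsupp.prod]
  rw [← MvPolynomial.monomial_sum_prod]
  congr 2
  conv_rhs => rw [← Finsupp.sum_single k]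
  refine Finset.sum_congr rfl fun n _ => ?_
  rw [Finsupp.smul_single, smul_eq_mul, mul_one]

/-- The exponential formula applied to `𝗓_(𝔩,0)`, with `k!` cancelling. Non-subcritical `(𝔩,k)` are
killed by `D^k` on one side and absent from `β` on the other. -/
theorem Char.hierarchyRHS_series [Fintype L] (f : S.Char) {β : MI (Coord d L)}
    (hβ : S.Subcrit β) (ξ : Option L → ℝ) :
    hierarchyRHS (fun n γ => MvPowerSeries.coeff γ (f.series n)) ξ β =
      MvPowerSeries.coeff β (f.gamma (∑ l, ξ l • MvPowerSeries.X (.inl (l, 0)))) := by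
  classical
  obtain ⟨B, hβB, hB⟩ := S.exists_bound β
  rw [hierarchyRHS_eq, f.coeff_gamma hβB hB, truncExp_symbol, map_sum, map_sum,
    finsum_eq_sum_of_support_subset
      (s := (Finset.univ : Finset (Option L)) ×ˢ multiIndices (Finset.Iic B) (β.degree + 1)),
    Finset.sum_product, Finset.sum_comm]
  · refine Finset.sum_congr rfl fun k _ => ?_
    rw [LinearMap.map_smul_of_tower, normalOrder_monomial, map_sum, Finset.mul_sum,
      Finset.smul_sum, map_sum]
    refine Finset.sum_congr rfl fun l _ => ?_
    rw [(S.Dpow k).map_smul, Dpow_X_inl_zero]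
    have h0 : (miFactorial k : ℝ) ≠ 0 := by
      rw [Nat.cast_ne_zero]
      exact Finset.prod_ne_zero_iff.2 fun i _ => Nat.factorial_ne_zero _
    split_ifs with h
    · rw [mul_smul_comm, mul_smul_comm, map_smul, map_smul, map_smul, mul_comm (k.prod _)]
      simp only [smul_eq_mul]
      field_simp
    · have : β (.inl (l, k)) = 0 := by
        by_contra hne
        exact h (hβ _ hne)
      rw [coeff_X_mul_eq_zero this]
      simp
  -- A contributing pair is subcritical, which gives `n ≤ B` on the support of `k`; and more than
  -- `|β|` factors without constant term cannot reach `β`.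
  · rintro ⟨l, k⟩ hp
    have h1 := left_ne_zero_of_mul hp
    have hsub : S.SubcritPair (l, k) := hβ _ (coeff_X_mul_ne_zero h1).1
    refine Finset.mem_coe.2 (Finset.mem_product.2 ⟨Finset.mem_univ _, mem_multiIndices.2
      ⟨fun n hn => Finset.mem_Iic.2 (hB n (hsub.deg_lt hn)), ?_⟩⟩)
    by_contra hlen
    refine h1 ?_
    rw [mul_comm]
    exact coeff_mul_eq_zero_of_mem_belowIdeal (ker_constantCoeff_pow_le β (Nat.lt_succ_self _)
      (Ideal.pow_le_pow_right (not_lt.1 hlen) (f.prod_series_mem k))) _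

/-- The jet of an expansion, as power series. -/
def jetSeries (P : MI (Coord d L) → (Fin d → ℝ) → ℝ) (y : Fin d → ℝ) (n : Idx d) : PS d L :=
  fun γ => taylorCoeff n (P γ) y

theorem coeff_jetSeries (P : MI (Coord d L) → (Fin d → ℝ) → ℝ) (y : Fin d → ℝ) (n : Idx d)
    (γ : MI (Coord d L)) :
    MvPowerSeries.coeff γ (jetSeries P y n) = taylorCoeff n (P γ) y := rfl

open scoped Classical in
/-- The increments of the jet of an expansion, as power series. -/
def jetIncrement (P : MI (Coord d L) → (Fin d → ℝ) → ℝ) (y : Fin d → ℝ) (n : Idx d) : PS d L :=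
  fun γ => taylorCoeff n (P γ) y - if γ = e (.inr n) then 1 else 0

open scoped Classical in
theorem coeff_jetIncrement (P : MI (Coord d L) → (Fin d → ℝ) → ℝ) (y : Fin d → ℝ) (n : Idx d)
    (γ : MI (Coord d L)) : MvPowerSeries.coeff γ (jetIncrement P y n) =
      taylorCoeff n (P γ) y - if γ = e (.inr n) then 1 else 0 := rfl

theorem modelChar_val_zero (x : Fin d → ℝ) (P : MI (Coord d L) → (Fin d → ℝ) → ℝ) (y : Fin d → ℝ)
    (u : Idx d) : (S.modelChar x P y).val 0 u = ∏ i, (y i - x i) ^ u i := by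
  rw [Char.val_eq, Finsupp.prod_zero_index, one_mul]
  simp [modelChar]

/-- At `e_𝐦` the Taylor coefficient of `(y-x)^𝐦` is `binom(𝐦,𝐧)(y-x)^{𝐦-𝐧}`. It is zero unless `𝐧 ≤
𝐦`, and the subtracted delta removes exactly the case `𝐧 = 𝐦`, which `f^(𝐧)` excludes. -/
theorem IsExpansion.jetIncrement_eq {x : Fin d → ℝ} {P : MI (Coord d L) → (Fin d → ℝ) → ℝ}
    (hP : S.IsExpansion x P) (y : Fin d → ℝ) {n : Idx d} (hn : S.deg n < S.η) :
    jetIncrement P y n = (S.modelChar x P y).series n := by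
  classical
  ext γ
  rw [coeff_jetIncrement]
  by_cases hγ : γ ∈ S.N
  · have hne : γ ≠ e (.inr n) := fun h => S.e_inr_notMem_N n (h ▸ hγ)
    rw [(S.modelChar x P y).coeff_series_of_mem hγ hn, if_neg hne, sub_zero]
    simp [modelChar]
  · by_cases hm : ∃ m, γ = e (.inr m)
    · obtain ⟨m, rfl⟩ := hm
      have hPm : P (e (.inr m)) = fun y => ∏ j, (y j - x j) ^ m j := funext (hP.polynomial m)
      rw [hPm, taylorCoeff_monomial]
      by_cases hlt : n < m
      · have hne : (e (Sum.inr m) : MI (Coord d L)) ≠ e (.inr n) := fun h => hlt.ne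
          (Sum.inr_injective (Finsupp.single_left_injective one_ne_zero h)).symm
        rw [(S.modelChar x P y).coeff_series_e hlt, modelChar_val_zero, if_neg hne, sub_zero]
      · rw [(S.modelChar x P y).coeff_series_eq_zero (fun h => hγ h.1) fun m' h => by
          rwa [← (Sum.inr_injective (Finsupp.single_left_injective one_ne_zero h))]]
        by_cases hnm : n = m
        · subst hnm
          simp [idxChoose_self]
        · have hne : (e (Sum.inr m) : MI (Coord d L)) ≠ e (.inr n) := fun h => hnm
            (Sum.inr_injective (Finsupp.single_left_injective one_ne_zero h)).symm
          obtain ⟨i, hi⟩ : ∃ i, ¬ n i ≤ m i := by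
            by_contra! h
            exact hlt (lt_of_le_of_ne h hnm)
          have h0 : idxChoose m n = 0 :=
            Finset.prod_eq_zero (Finset.mem_univ i) (Nat.choose_eq_zero_of_lt (not_le.1 hi))
          rw [if_neg hne, h0]
          simp
    · have hpop : γ ∉ S.populated := by
        rintro (⟨m, rfl⟩ | h)
        · exact hm ⟨m, rfl⟩
        · exact hγ h
      rw [hP.populated γ hpop, taylorCoeff_zero, if_neg (fun h => hm ⟨n, h⟩),
        (S.modelChar x P y).coeff_series_eq_zero (fun h => hγ h.1) fun m h => absurd ⟨m, h⟩ hm,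
        sub_zero]

theorem IsExpansion.incrementRHS_eq [Fintype L] {x : Fin d → ℝ}
    {P : MI (Coord d L) → (Fin d → ℝ) → ℝ} (hP : S.IsExpansion x P) (ξ : L → (Fin d → ℝ) → ℝ)
    {β : MI (Coord d L)} (hβ : β ∈ S.N) : incrementRHS P ξ β = S.gammaRHS x P ξ β := by
  funext y
  rw [gammaRHS, ← Char.hierarchyRHS_series _ hβ.1.2.1, incrementRHS]
  refine hierarchyRHS_congr (h := jetIncrement P y) hβ.1.2.1 (fun n hn => ?_) _
  rw [hP.jetIncrement_eq y hn, sub_self]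
  exact zero_mem _

/-- For the relevant `|𝐧| < η` the delta sits at `e_𝐧`, which is not below `β`. -/
theorem plainRHS_eq_incrementRHS {P : MI (Coord d L) → (Fin d → ℝ) → ℝ}
    (ξ : L → (Fin d → ℝ) → ℝ) {β : MI (Coord d L)} (hβ : S.Subcrit β)
    (hpoly : ∀ n, S.deg n < S.η → β (.inr n) = 0) : plainRHS P ξ β = incrementRHS P ξ β := by
  classical
  funext y
  refine hierarchyRHS_congr (h := jetSeries P y) (h' := jetIncrement P y) hβ
    (fun n hn γ hγ => ?_) _
  rw [map_sub, coeff_jetSeries, coeff_jetIncrement, if_neg, sub_zero]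
  · exact sub_self _
  · rintro rfl
    have := hγ (.inr n)
    simp [hpoly n hn] at this

end Setting

end MultiIndex

end

open MultiIndex in
theorem mainTheorem2 {d : ℕ} {L : Type*} [Fintype L] (S : Setting d L) :
    (∀ f : S.Char,
      (∀ n, f.series n ∈ Setting.T S.populated) ∧
      (∀ β, {q | ∃ π ∈ Setting.T S.Nminus,
        MvPowerSeries.coeff β (f.gammaTerm q π) ≠ 0}.Finite) ∧
      (∀ β, {ν : (l : ℕ) × (Fin l → Idx d) | ∃ π ∈ Setting.T S.Nminus,
        MvPowerSeries.coeff β (f.expTerm ν.2 π) ≠ 0}.Finite) ∧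
      (∀ π ∈ Setting.T S.Nminus, f.gamma π = f.exponential π) ∧
      ((∀ i, S.regsol ≤ S.s i) →
        ∀ π ∈ Setting.T S.Nminus, f.gamma π ∈ Setting.T S.Nminus)) ∧
    (∀ (x : Fin d → ℝ) (P : MI (Coord d L) → (Fin d → ℝ) → ℝ) (ξ : L → (Fin d → ℝ) → ℝ),
      S.IsExpansion x P →
      (∀ β ∈ S.N, incrementRHS P ξ β = S.gammaRHS x P ξ β) ∧
      (∀ β ∈ S.N, (∀ n, S.deg n < S.η → β (.inr n) = 0) →
        plainRHS P ξ β = S.gammaRHS x P ξ β) ∧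
      (∀ ℒ : ((Fin d → ℝ) → ℝ) → ((Fin d → ℝ) → ℝ),
        (∀ β ∈ S.N, ℒ (P β) = incrementRHS P ξ β) ↔
          (∀ β ∈ S.N, ℒ (P β) = S.gammaRHS x P ξ β))) := by
  refine ⟨fun f => ⟨f.series_mem_populated, fun β => ?_, fun β => ?_,
    fun π _ => f.gamma_eq_exponential π, fun h π hπ => f.gamma_mem h hπ⟩, fun x P ξ hP =>
    ⟨fun β hβ => hP.incrementRHS_eq ξ hβ, fun β hβ hpoly => ?_, fun ℒ => ?_⟩⟩
  -- The finiteness is uniform over all power series `π`, in particular over those supported on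
  -- `𝒩⁻`.
  · exact (f.finite_gammaTerm β).subset fun q ⟨π, _, h⟩ => ⟨π, h⟩
  · exact (f.finite_expTerm β).subset fun ν ⟨π, _, h⟩ => ⟨π, h⟩
  · rw [Setting.plainRHS_eq_incrementRHS ξ hβ.1.2.1 hpoly, hP.incrementRHS_eq ξ hβ]
  · refine forall₂_congr fun β hβ => ?_
    rw [hP.incrementRHS_eq ξ hβ]
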